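/- **Conventions.** All algebras are unital and over $\mathbb C$; homomorphisms are unital. An *Arens–Michael algebra* is a complete Hausdorff topological algebra whose topology is determined by a system of submultiplicative seminorms. $\mathcal F_n$ denotes the algebra of free entire functions in $n$ generators, i.e. the Arens–Michael envelope (the completion with respect to all submultiplicative seminorms) of the free algebra $\mathbb C\langle\zeta_1,\dots,\zeta_n\rangle$. An Arens–Michael algebra $A$ is *holomorphically finitely generated* (HFG) if it is metrizable (Fréchet) and, for some $n$, there is a surjective continuous homomorphism $\mathcal F_n\to A$. $\widehat\otimes$ is the complete projective tensor product; a *Hopf $\widehat\otimes$-algebra* is a Hopf algebra in the monoidal category of complete Hausdorff locally convex spaces with $\widehat\otimes$, and an *HFG Hopf algebra* is a Hopf $\widehat\otimes$-algebra whose underlying algebra is HFG. In a topological algebra $e^a=\sum_{n\ge0}a^n/n!$ and $\sinh a=(e^a-e^{-a})/2$. **Proposition.** Let $\hbar\in\mathbb C$ with $\sinh\hbar\neq0$, and let $\widetilde U(\mathfrak{sl}_2)_\hbar$ be the quotient of $\mathcal F_3$, with generators $E,F,H$, by the closed two-sided ideal generated by the relations $$[H,E]=2E,\qquad [H,F]=-2F,\qquad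 [E,F]=\frac{\sinh \hbar H}{\sinh\hbar}.$$ Then: 1. $\widetilde U(\mathfrak{sl}_2)_\hbar$ is the universal HFG algebra generated by $E,F,H$ subject to these relations: it is HFG, the relations hold in it, and for every HFG algebra $B$ and all $e,f,h\in B$ satisfying the same relations there is a unique continuous homomorphism $\varphi:\widetilde U(\mathfrak{sl}_2)_\hbar\to B$ with $\varphi(E)=e$, $\varphi(F)=f$, $\varphi(H)=h$. 2. $\widetilde U(\mathfrak{sl}_2)_\hbar$ is infinite-dimensional. 3. There are a unique continuous homomorphism $\Delta:\widetilde U(\mathfrak{sl}_2)_\hbar\to\widetilde U(\mathfrak{sl}_2)_\hbar\mathbin{\widehat\otimes}\widetilde U(\mathfrak{sl}_2)_\hbar$, a unique continuous homomorphism $\varepsilon:\widetilde U(\mathfrak{sl}_2)_\hbar\to\mathbb C$ and a unique continuous unital antihomomorphism $S:\widetilde U(\mathfrak{sl}_2)_\hbar\to\widetilde U(\mathfrak{sl}_2)_\hbar$ with $$\Delta(H)=H\otimes1+1\otimes H,\quad \Delta(E)=E\otimes e^{\hbar H}+1\otimes E,\quad \Delta(F)=F\otimes1+e^{-\hbar H}\otimes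 F,$$ $$\varepsilon(H)=\varepsilon(E)=\varepsilon(F)=0,$$ $$S(H)=-H,\quad S(E)=-E\,e^{-\hbar H},\quad S(F)=-e^{\hbar H}F,$$ and with the comultiplication $\Delta$, the counit $\varepsilon$ and the antipode $S$, $\widetilde U(\mathfrak{sl}_2)_\hbar$ is a Hopf $\widehat\otimes$-algebra, hence an HFG Hopf algebra. 4. $S$ is invertible, with a continuous linear inverse. -/

import Mathlib

open scoped TensorProduct Topology
open UniformSpace (Completion)

namespace HFG
noncomputable section

section LocallyConvex

variable {E : Type*} [AddCommGroup E] [Module ℂ E] [TopologicalSpace E]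
variable {F : Type*} [AddCommGroup F] [Module ℂ F] [TopologicalSpace F]
variable {G : Type*} [AddCommGroup G] [Module ℂ G]

theorem exists_seminorm_of_mem_nhds [PolynormableSpace ℂ E] {U : Set E} (hU : U ∈ 𝓝 (0 : E)) :
    ∃ p : Seminorm ℂ E, Continuous p ∧ ∀ x, p x < 1 → x ∈ U := by
  have hw := PolynormableSpace.withSeminorms ℂ E
  obtain ⟨⟨t, ε⟩, hε, ht⟩ := hw.hasBasis_zero_ball.mem_iff.1 hU
  have : IsTopologicalAddGroup E := hw.topologicalAddGroup
  let P : Seminorm ℂ E := t.sup (fun p : {p : Seminorm ℂ E // Continuous p} => p.1)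
  have hP : Continuous P := Seminorm.continuous_finsetSup fun i _ => i.2
  let c : NNReal := ⟨ε⁻¹, (inv_pos.2 hε).le⟩
  refine ⟨c • P, hP.const_smul c, fun x hx => ht ?_⟩
  rw [Seminorm.mem_ball_zero]
  change ε⁻¹ * P x < 1 at hx
  rwa [inv_mul_lt_iff₀ hε, mul_one] at hx

theorem polynormable_of_nhds [IsTopologicalAddGroup E]
    (h : ∀ U ∈ 𝓝 (0 : E), ∃ p : Seminorm ℂ E, Continuous p ∧ ∀ x, p x < 1 → x ∈ U) :
    PolynormableSpace ℂ E := by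
  refine ⟨?_⟩
  rw [SeminormFamily.withSeminorms_iff_nhds_eq_iInf]
  refine le_antisymm ?_ ?_
  · simp_rw [le_iInf_iff, ← Filter.tendsto_iff_comap]
    rintro ⟨p, hp⟩
    exact hp.tendsto' 0 0 (map_zero _)
  · intro U hU
    obtain ⟨p, hp, hpU⟩ := h U hU
    refine Filter.mem_iInf_of_mem ⟨p, hp⟩ ?_
    exact Filter.mem_of_superset (Filter.preimage_mem_comap (Iio_mem_nhds one_pos)) hpU

theorem tendsto_zero_of_seminorms {ι : Type*} {p : SeminormFamily ℂ E ι} (hp : WithSeminorms p)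
    {α : Type*} {l : Filter α} {f : α → E}
    (hf : ∀ i, Filter.Tendsto (fun a => p i (f a)) l (𝓝 0)) :
    Filter.Tendsto f l (𝓝 0) := by
  have := hp.topologicalAddGroup
  rw [p.withSeminorms_iff_nhds_eq_iInf.1 hp, Filter.tendsto_iInf]
  exact fun i => Filter.tendsto_comap_iff.2 (hf i)

/-- A jointly continuous "seminorm of a bilinear map" is dominated by a product of continuous
seminorms. -/
theorem exists_bound_of_continuous [PolynormableSpace ℂ E] [PolynormableSpace ℂ F]
    (β : E →ₗ[ℂ] F →ₗ[ℂ] G) (q : Seminorm ℂ G)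
    (h : Continuous fun z : E × F => q (β z.1 z.2)) :
    ∃ (r : Seminorm ℂ E) (s : Seminorm ℂ F), Continuous r ∧ Continuous s ∧
      ∀ x y, q (β x y) ≤ r x * s y := by
  have h0 : {z : E × F | q (β z.1 z.2) < 1} ∈ 𝓝 ((0 : E), (0 : F)) :=
    (isOpen_lt h continuous_const).mem_nhds (by simp)
  obtain ⟨U, hU, V, hV, hUV⟩ := mem_nhds_prod_iff.1 h0
  obtain ⟨r, hr, hrU⟩ := exists_seminorm_of_mem_nhds hU
  obtain ⟨s, hs, hsV⟩ := exists_seminorm_of_mem_nhds hV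
  refine ⟨r, s, hr, hs, fun x y => ?_⟩
  have key : ∀ δ : ℝ, 0 < δ → q (β x y) ≤ (r x + δ) * (s y + δ) := by
    intro δ hδ
    have hc : 0 < r x + δ := add_pos_of_nonneg_of_pos (apply_nonneg r x) hδ
    have hd : 0 < s y + δ := add_pos_of_nonneg_of_pos (apply_nonneg s y) hδ
    have h1 : r (((r x + δ)⁻¹ : ℂ) • x) < 1 := by
      rw [map_smul_eq_mul, ← Complex.ofReal_add, ← Complex.ofReal_inv, Complex.norm_real,
        Real.norm_of_nonneg (inv_pos.2 hc).le, inv_mul_lt_iff₀ hc]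
      linarith
    have h2 : s (((s y + δ)⁻¹ : ℂ) • y) < 1 := by
      rw [map_smul_eq_mul, ← Complex.ofReal_add, ← Complex.ofReal_inv, Complex.norm_real,
        Real.norm_of_nonneg (inv_pos.2 hd).le, inv_mul_lt_iff₀ hd]
      linarith
    have h3 := hUV (Set.mk_mem_prod (hrU _ h1) (hsV _ h2))
    simp only [Set.mem_ofPred_eq, map_smul, LinearMap.smul_apply, map_smul_eq_mul,
      ← Complex.ofReal_add, ← Complex.ofReal_inv, Complex.norm_real] at h3
    rw [Real.norm_of_nonneg (inv_pos.2 hc).le, Real.norm_of_nonneg (inv_pos.2 hd).le,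
      inv_mul_lt_iff₀ hd, mul_one, inv_mul_lt_iff₀ hc] at h3
    linarith
  have hlim : Filter.Tendsto (fun δ : ℝ => (r x + δ) * (s y + δ)) (𝓝[>] 0) (𝓝 (r x * s y)) := by
    have : Continuous fun δ : ℝ => (r x + δ) * (s y + δ) := by fun_prop
    exact (this.tendsto' 0 _ (by simp)).mono_left nhdsWithin_le_nhds
  exact ge_of_tendsto hlim (Filter.eventually_of_mem self_mem_nhdsWithin key)

/-- A bilinear map into a locally convex space is jointly continuous as soon as each
seminorm of its values in a defining family is dominated by a product of continuous seminorms. -/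
theorem continuous_of_exists_bound [TopologicalSpace G] {ι : Type*} {p : SeminormFamily ℂ G ι}
    (hp : WithSeminorms p) [IsTopologicalAddGroup E] [IsTopologicalAddGroup F]
    (β : E →ₗ[ℂ] F →ₗ[ℂ] G)
    (h : ∀ i, ∃ (r : Seminorm ℂ E) (s : Seminorm ℂ F),
      Continuous r ∧ Continuous s ∧ ∀ x y, p i (β x y) ≤ r x * s y) :
    Continuous fun z : E × F => β z.1 z.2 := by
  have : IsTopologicalAddGroup G := hp.topologicalAddGroup
  refine continuous_of_continuousAt_zero₂
    (f := (AddMonoidHom.mk' (fun x : E => (β x).toAddMonoidHom)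
      (fun a b => by ext; simp) : E →+ F →+ G)) ?_ (fun x => ?_) (fun y => ?_)
  · simp only [ContinuousAt, AddMonoidHom.mk'_apply, LinearMap.toAddMonoidHom_coe, map_zero]
    refine tendsto_zero_of_seminorms hp fun i => ?_
    obtain ⟨r, s, hr, hs, hb⟩ := h i
    have : Continuous fun z : E × F => r z.1 * s z.2 := by fun_prop
    exact squeeze_zero (fun z => apply_nonneg _ _) (fun z => hb z.1 z.2)
      (this.tendsto' _ _ (by simp))
  · simp only [ContinuousAt, AddMonoidHom.mk'_apply, LinearMap.toAddMonoidHom_coe, map_zero]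
    refine tendsto_zero_of_seminorms hp fun i => ?_
    obtain ⟨r, s, hr, hs, hb⟩ := h i
    have : Continuous fun y : F => r x * s y := by fun_prop
    exact squeeze_zero (fun z => apply_nonneg _ _) (fun y => hb x y)
      (this.tendsto' _ _ (by simp))
  · simp only [ContinuousAt, AddMonoidHom.mk'_apply, LinearMap.toAddMonoidHom_coe, map_zero]
    refine tendsto_zero_of_seminorms hp fun i => ?_
    obtain ⟨r, s, hr, hs, hb⟩ := h i
    have : Continuous fun x : E => r x * s y := by fun_prop
    exact squeeze_zero (fun z => apply_nonneg _ _) (fun x => hb x y)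
      (this.tendsto' _ _ (by simp))

end LocallyConvex

section Completion
variable {E : Type*} [AddCommGroup E] [Module ℂ E] [UniformSpace E] [IsUniformAddGroup E]
  [UniformContinuousConstSMul ℂ E]

/-- The extension of a continuous seminorm to the completion. -/
def completionSeminorm (p : Seminorm ℂ E) (hp : Continuous p) : Seminorm ℂ (Completion E) :=
  have hu : UniformContinuous p := Seminorm.uniformContinuous_of_continuousAt_zero hp.continuousAt
  Seminorm.of (Completion.extension p)
    (fun x y => Completion.induction_on₂ x y
      (isClosed_le (Completion.continuous_extension.comp continuous_add)
        ((Completion.continuous_extension.comp continuous_fst).add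
          (Completion.continuous_extension.comp continuous_snd)))
      fun a b => by
        rw [← Completion.coe_add, Completion.extension_coe hu, Completion.extension_coe hu,
          Completion.extension_coe hu]
        exact map_add_le_add p a b)
    (fun c x => Completion.induction_on x
      (isClosed_eq (Completion.continuous_extension.comp (continuous_const_smul c))
        (continuous_const.mul Completion.continuous_extension))
      fun a => by
        rw [← Completion.coe_smul, Completion.extension_coe hu, Completion.extension_coe hu,
          map_smul_eq_mul])

theorem completionSeminorm_coe (p : Seminorm ℂ E) (hp : Continuous p) (x : E) :
    completionSeminorm p hp (x : Completion E) = p x :=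
  Completion.extension_coe (Seminorm.uniformContinuous_of_continuousAt_zero hp.continuousAt) x

theorem continuous_completionSeminorm (p : Seminorm ℂ E) (hp : Continuous p) :
    Continuous (completionSeminorm p hp) :=
  Completion.continuous_extension

instance instPolynormableCompletion [PolynormableSpace ℂ E] :
    PolynormableSpace ℂ (Completion E) := by
  refine polynormable_of_nhds fun U hU => ?_
  obtain ⟨V, hV, hVc, hVU⟩ := exists_mem_nhds_isClosed_subset hU
  have hV' : ((↑) : E → Completion E) ⁻¹' V ∈ 𝓝 (0 : E) :=
    (Completion.continuous_coe E).continuousAt.preimage_mem_nhds (by rwa [Completion.coe_zero])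
  obtain ⟨p, hp, hpV⟩ := exists_seminorm_of_mem_nhds hV'
  refine ⟨completionSeminorm p hp, continuous_completionSeminorm p hp, fun x hx => hVU ?_⟩
  have ho : IsOpen {y | completionSeminorm p hp y < 1} :=
    isOpen_lt (continuous_completionSeminorm p hp) continuous_const
  refine hVc.closure_subset_iff.2 ?_
    (Completion.denseRange_coe.open_subset_closure_inter ho hx)
  rintro _ ⟨hy, a, rfl⟩
  exact hpV a (by simpa [completionSeminorm_coe] using hy)

instance [PolynormableSpace ℂ E] : ContinuousSMul ℂ (Completion E) :=
  (PolynormableSpace.withSeminorms ℂ (Completion E)).continuousSMul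

end Completion

section ProjectiveTensor

/-- The algebraic tensor product `E ⊗ F` over `ℂ`, to be endowed with the projective topology. -/
def ProjTensor (E F : Type*) [AddCommGroup E] [Module ℂ E] [AddCommGroup F] [Module ℂ F] :=
  E ⊗[ℂ] F

section Basic

variable (E : Type*) [AddCommGroup E] [Module ℂ E]
variable (F : Type*) [AddCommGroup F] [Module ℂ F]

instance : AddCommGroup (ProjTensor E F) := inferInstanceAs (AddCommGroup (E ⊗[ℂ] F))
instance : Module ℂ (ProjTensor E F) := inferInstanceAs (Module ℂ (E ⊗[ℂ] F))

/-- The bilinear map `(x, y) ↦ x ⊗ y` into the algebraic tensor product. -/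
def ProjTensor.mk : E →ₗ[ℂ] F →ₗ[ℂ] ProjTensor E F := TensorProduct.mk ℂ E F

variable [TopologicalSpace E] [TopologicalSpace F]

/-- The seminorms on `E ⊗ F` that define the projective topology: those dominated on elementary
tensors by `r x * s y` for some continuous seminorms `r`, `s` of the factors (the largest seminorm
dominated by given `r` and `s` is the usual tensor product seminorm `r ⊗ s`). -/
def ProjSeminorm : Type _ :=
  {p : Seminorm ℂ (ProjTensor E F) // ∃ (r : Seminorm ℂ E) (s : Seminorm ℂ F),
    Continuous r ∧ Continuous s ∧ ∀ x y, p (ProjTensor.mk E F x y) ≤ r x * s y}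

/-- The uniform structure of the projective topology. -/
instance : UniformSpace (ProjTensor E F) :=
  ⨅ p : ProjSeminorm E F, p.1.toSeminormedAddCommGroup.toUniformSpace

instance : IsUniformAddGroup (ProjTensor E F) :=
  isUniformAddGroup_iInf fun p =>
    letI := p.1.toSeminormedAddCommGroup
    inferInstance

theorem ProjTensor.withSeminorms :
    WithSeminorms (fun p : ProjSeminorm E F => p.1) :=
  (SeminormFamily.withSeminorms_iff_uniformSpace_eq_iInf _).2 rfl

instance : PolynormableSpace ℂ (ProjTensor E F) :=
  (ProjTensor.withSeminorms E F).toPolynormableSpace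

instance : ContinuousSMul ℂ (ProjTensor E F) := (ProjTensor.withSeminorms E F).continuousSMul

instance : UniformContinuousConstSMul ℂ (ProjTensor E F) :=
  uniformContinuousConstSMul_of_continuousConstSMul _ _

/-- The complete projective tensor product `E ⊗̂ F`: the (Hausdorff) completion of `E ⊗ F` with
respect to the projective topology. -/
abbrev CTensor : Type _ := Completion (ProjTensor E F)

/-- The canonical bilinear map `(x, y) ↦ x ⊗ y` into the complete projective tensor product. -/
def CTensor.mk : E →ₗ[ℂ] F →ₗ[ℂ] CTensor E F :=
  LinearMap.mk₂ ℂ (fun x y => ((ProjTensor.mk E F x y : ProjTensor E F) : CTensor E F))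
    (by intros; simp [Completion.coe_add]) (by intros; simp [Completion.coe_smul])
    (by intros; simp [Completion.coe_add]) (by intros; simp [Completion.coe_smul])

end Basic

variable {E : Type*} [AddCommGroup E] [Module ℂ E]
variable {F : Type*} [AddCommGroup F] [Module ℂ F]
variable {G : Type*} [AddCommGroup G] [Module ℂ G]

@[elab_as_elim]
theorem ProjTensor.induction_on {P : ProjTensor E F → Prop} (z : ProjTensor E F) (zero : P 0)
    (tmul : ∀ x y, P (ProjTensor.mk E F x y)) (add : ∀ x y, P x → P y → P (x + y)) : P z :=
  TensorProduct.induction_on (motive := P) z zero tmul add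

variable [TopologicalSpace E] [TopologicalSpace F]

/-- For continuous seminorms `r`, `s` there is a continuous seminorm on `E ⊗ F` that dominates
every seminorm dominated by `r x * s y` on elementary tensors. -/
theorem ProjTensor.exists_seminorm {r : Seminorm ℂ E} {s : Seminorm ℂ F} (hr : Continuous r)
    (hs : Continuous s) : ∃ P : Seminorm ℂ (ProjTensor E F), Continuous P ∧
      ∀ (q : Seminorm ℂ (ProjTensor E F)) (C : ℝ), 0 ≤ C →
        (∀ x y, q (ProjTensor.mk E F x y) ≤ C * (r x * s y)) → ∀ z, q z ≤ C * P z := by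
  let S : Set (Seminorm ℂ (ProjTensor E F)) :=
    {q | ∀ x y, q (ProjTensor.mk E F x y) ≤ r x * s y}
  have hne : S.Nonempty := ⟨0, fun x y => mul_nonneg (apply_nonneg r x) (apply_nonneg s y)⟩
  have hS : BddAbove S := by
    have hb : ∀ z : ProjTensor E F, ∃ C : ℝ, ∀ q ∈ S, q z ≤ C := by
      intro z
      induction z using ProjTensor.induction_on with
      | zero => exact ⟨0, fun q _ => by simp⟩
      | tmul x y => exact ⟨r x * s y, fun q hq => hq x y⟩
      | add x y hx hy =>
        obtain ⟨a, ha⟩ := hx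
        obtain ⟨b, hb⟩ := hy
        exact ⟨a + b, fun q hq => (map_add_le_add q x y).trans (add_le_add (ha q hq) (hb q hq))⟩
    choose C hC using hb
    rw [Seminorm.bddAbove_iff]
    exact ⟨C, by rintro _ ⟨q, hq, rfl⟩ z; exact hC z q hq⟩
  have hP : ∀ x y, (sSup S) (ProjTensor.mk E F x y) ≤ r x * s y := by
    intro x y
    rw [Seminorm.sSup_apply hS]
    have : Nonempty S := hne.to_subtype
    exact ciSup_le fun q => q.2 x y
  refine ⟨sSup S, (ProjTensor.withSeminorms E F).continuous_seminorm ⟨sSup S, r, s, hr, hs, hP⟩,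
    fun q C hC hq z => ?_⟩
  rcases hC.eq_or_lt with rfl | hC
  · have : q z = 0 := by
      induction z using ProjTensor.induction_on with
      | zero => simp
      | tmul x y => exact le_antisymm (by simpa using hq x y) (apply_nonneg _ _)
      | add x y hx hy =>
        exact le_antisymm ((map_add_le_add q x y).trans (by rw [hx, hy, add_zero]))
          (apply_nonneg _ _)
    simp [this]
  · let c : NNReal := ⟨C⁻¹, (inv_pos.2 hC).le⟩
    have hmem : c • q ∈ S := by
      intro x y
      change C⁻¹ * q _ ≤ _
      rw [inv_mul_le_iff₀ hC]
      exact hq x y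
    have h1 : (c • q) z ≤ sSup S z := le_csSup hS hmem z
    change C⁻¹ * q z ≤ _ at h1
    rwa [inv_mul_le_iff₀ hC] at h1

theorem CTensor.mk_apply (x : E) (y : F) :
    CTensor.mk E F x y = ((ProjTensor.mk E F x y : ProjTensor E F) : CTensor E F) := rfl

theorem CTensor.continuous_mk [IsTopologicalAddGroup E] [IsTopologicalAddGroup F] :
    Continuous fun z : E × F => CTensor.mk E F z.1 z.2 :=
  (Completion.continuous_coe (ProjTensor E F)).comp
    (continuous_of_exists_bound (ProjTensor.withSeminorms E F) (ProjTensor.mk E F) fun p => p.2)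

theorem ProjTensor.continuous_seminorm {p : Seminorm ℂ (ProjTensor E F)} {r : Seminorm ℂ E}
    {s : Seminorm ℂ F} (hr : Continuous r) (hs : Continuous s)
    (h : ∀ x y, p (ProjTensor.mk E F x y) ≤ r x * s y) : Continuous p :=
  (ProjTensor.withSeminorms E F).continuous_seminorm ⟨p, r, s, hr, hs, h⟩

/-- Two continuous linear maps on `E ⊗̂ F` that agree on elementary tensors are equal. -/
theorem CTensor.hom_ext {H : Type*} [AddCommGroup H] [Module ℂ H] [TopologicalSpace H] [T2Space H]
    {f g : CTensor E F →L[ℂ] H}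
    (h : ∀ x y, f (CTensor.mk E F x y) = g (CTensor.mk E F x y)) : f = g := by
  ext z
  induction z using Completion.induction_on with
  | hp => exact isClosed_eq f.continuous g.continuous
  | ih z =>
    induction z using ProjTensor.induction_on with
    | zero => simp [Completion.coe_zero]
    | tmul x y => exact h x y
    | add x y hx hy => rw [Completion.coe_add, map_add, map_add, hx, hy]

section Lift

variable [PolynormableSpace ℂ E] [PolynormableSpace ℂ F]
variable [UniformSpace G] [PolynormableSpace ℂ G]

/-- The linear map on `E ⊗ F` induced by a bilinear map. -/
def ProjTensor.liftLinear {E F G : Type*} [AddCommGroup E] [Module ℂ E] [AddCommGroup F]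
    [Module ℂ F] [AddCommGroup G] [Module ℂ G] (β : E →ₗ[ℂ] F →ₗ[ℂ] G) :
    ProjTensor E F →ₗ[ℂ] G :=
  (TensorProduct.lift β : E ⊗[ℂ] F →ₗ[ℂ] G)

/-- The continuous linear map on `E ⊗ F` induced by a jointly continuous bilinear map. -/
def ProjTensor.lift (β : E →ₗ[ℂ] F →ₗ[ℂ] G) (hβ : Continuous fun z : E × F => β z.1 z.2) :
    ProjTensor E F →L[ℂ] G where
  toLinearMap := ProjTensor.liftLinear β
  cont := by
    refine (PolynormableSpace.withSeminorms ℂ G).continuous_of_continuous_comp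
      (ProjTensor.liftLinear β) fun q => ?_
    obtain ⟨r, s, hr, hs, h⟩ := exists_bound_of_continuous β q.1 (q.2.comp hβ)
    refine ProjTensor.continuous_seminorm hr hs fun x y => ?_
    exact (h x y).trans_eq' (congrArg q.1 (TensorProduct.lift.tmul x y)).symm

@[simp]
theorem ProjTensor.lift_mk (β : E →ₗ[ℂ] F →ₗ[ℂ] G) (hβ : Continuous fun z : E × F => β z.1 z.2)
    (x : E) (y : F) : ProjTensor.lift β hβ (ProjTensor.mk E F x y) = β x y :=
  TensorProduct.lift.tmul x y

variable [IsUniformAddGroup G] [CompleteSpace G] [T0Space G] [UniformContinuousConstSMul ℂ G]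

/-- The universal property of `E ⊗̂ F`: the continuous linear map into a complete Hausdorff locally
convex space induced by a jointly continuous bilinear map. -/
def CTensor.lift (β : E →ₗ[ℂ] F →ₗ[ℂ] G) (hβ : Continuous fun z : E × F => β z.1 z.2) :
    CTensor E F →L[ℂ] G :=
  (ProjTensor.lift β hβ).fromCompletion

@[simp]
theorem CTensor.lift_mk (β : E →ₗ[ℂ] F →ₗ[ℂ] G) (hβ : Continuous fun z : E × F => β z.1 z.2)
    (x : E) (y : F) : CTensor.lift β hβ (CTensor.mk E F x y) = β x y := by
  rw [CTensor.mk_apply, CTensor.lift, ContinuousLinearMap.fromCompletion_apply_coe,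
    ProjTensor.lift_mk]

end Lift

section Map

variable [PolynormableSpace ℂ E] [PolynormableSpace ℂ F]
  [TopologicalSpace G]
variable {E' : Type*} [AddCommGroup E'] [Module ℂ E'] [TopologicalSpace E']
  [IsTopologicalAddGroup E']
variable {F' : Type*} [AddCommGroup F'] [Module ℂ F'] [TopologicalSpace F']
  [IsTopologicalAddGroup F']

/-- The tensor product `f ⊗̂ g` of two continuous linear maps. -/
def CTensor.map (f : E →L[ℂ] E') (g : F →L[ℂ] F') : CTensor E F →L[ℂ] CTensor E' F' :=
  CTensor.lift ((CTensor.mk E' F').compl₁₂ f.toLinearMap g.toLinearMap)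
    (CTensor.continuous_mk.comp
      ((f.continuous.comp continuous_fst).prodMk (g.continuous.comp continuous_snd)))

@[simp]
theorem CTensor.map_mk (f : E →L[ℂ] E') (g : F →L[ℂ] F') (x : E) (y : F) :
    CTensor.map f g (CTensor.mk E F x y) = CTensor.mk E' F' (f x) (g y) :=
  CTensor.lift_mk _ _ x y

end Map

section Assoc

/-- For `w : G`, the continuous linear map `y ↦ y ⊗ w`. -/
def CTensor.mkRight (F : Type*) {G : Type*} [AddCommGroup F] [Module ℂ F] [TopologicalSpace F]
    [AddCommGroup G] [Module ℂ G] [TopologicalSpace G] [IsTopologicalAddGroup F]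
    [IsTopologicalAddGroup G] (w : G) : F →L[ℂ] CTensor F G where
  toLinearMap := (CTensor.mk F G).flip w
  cont := CTensor.continuous_mk.comp (continuous_id.prodMk continuous_const)

theorem CTensor.mkRight_apply [IsTopologicalAddGroup F] [TopologicalSpace G]
    [IsTopologicalAddGroup G] (w : G) (y : F) : CTensor.mkRight F w y = CTensor.mk F G y w := rfl

variable (E F G)
variable [TopologicalSpace G]
  [IsTopologicalAddGroup E] [IsTopologicalAddGroup F] [IsTopologicalAddGroup G]
  [PolynormableSpace ℂ E] [PolynormableSpace ℂ F]

/-- The bilinear map `(x ⊗ y, w) ↦ x ⊗ (y ⊗ w)`. -/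
def CTensor.assocBilin : CTensor E F →ₗ[ℂ] G →ₗ[ℂ] CTensor E (CTensor F G) :=
  LinearMap.flip
    { toFun := fun w => (CTensor.map (ContinuousLinearMap.id ℂ E) (CTensor.mkRight F w)).toLinearMap
      map_add' := fun v w => by
        have : CTensor.map (ContinuousLinearMap.id ℂ E) (CTensor.mkRight F (v + w)) =
            CTensor.map (ContinuousLinearMap.id ℂ E) (CTensor.mkRight F v) +
            CTensor.map (ContinuousLinearMap.id ℂ E) (CTensor.mkRight F w) :=
          CTensor.hom_ext fun x y => by simp [CTensor.mkRight_apply]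
        rw [this]; rfl
      map_smul' := fun c w => by
        have : CTensor.map (ContinuousLinearMap.id ℂ E) (CTensor.mkRight F (c • w)) =
            c • CTensor.map (ContinuousLinearMap.id ℂ E) (CTensor.mkRight F w) :=
          CTensor.hom_ext fun x y => by simp [CTensor.mkRight_apply]
        rw [this]; rfl }

theorem CTensor.assocBilin_mk (x : E) (y : F) (w : G) :
    CTensor.assocBilin E F G (CTensor.mk E F x y) w =
      CTensor.mk E (CTensor F G) x (CTensor.mk F G y w) :=
  CTensor.map_mk _ _ x y

variable [PolynormableSpace ℂ G]

theorem CTensor.continuous_assocBilin :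
    Continuous fun z : CTensor E F × G => CTensor.assocBilin E F G z.1 z.2 := by
  refine continuous_of_exists_bound (PolynormableSpace.withSeminorms ℂ _) _ fun q => ?_
  obtain ⟨r, s', hr, hs', h1⟩ := exists_bound_of_continuous (CTensor.mk E (CTensor F G)) q.1
    (q.2.comp CTensor.continuous_mk)
  obtain ⟨s, t, hs, ht, h2⟩ := exists_bound_of_continuous (CTensor.mk F G) s'
    (hs'.comp CTensor.continuous_mk)
  obtain ⟨P, hP, hPmax⟩ := ProjTensor.exists_seminorm hr hs
  refine ⟨completionSeminorm P hP, t, continuous_completionSeminorm P hP, ht, fun z w => ?_⟩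
  induction z using Completion.induction_on with
  | hp =>
    exact isClosed_le
      (q.2.comp (CTensor.map (ContinuousLinearMap.id ℂ E) (CTensor.mkRight F w)).continuous)
      ((continuous_completionSeminorm P hP).mul continuous_const)
  | ih z =>
    rw [completionSeminorm_coe, mul_comm]
    let ι : ProjTensor E F →ₗ[ℂ] CTensor E F :=
      { toFun := fun z => (z : CTensor E F)
        map_add' := Completion.coe_add
        map_smul' := Completion.coe_smul }
    refine hPmax (q.1.comp (((CTensor.assocBilin E F G).flip w).comp ι)) (t w) (apply_nonneg t w)
      (fun x y => ?_) z
    calc q.1 (CTensor.assocBilin E F G (CTensor.mk E F x y) w)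
        = q.1 (CTensor.mk E (CTensor F G) x (CTensor.mk F G y w)) := by
          rw [CTensor.assocBilin_mk]
      _ ≤ r x * s' (CTensor.mk F G y w) := h1 _ _
      _ ≤ r x * (s y * t w) := mul_le_mul_of_nonneg_left (h2 y w) (apply_nonneg r x)
      _ = t w * (r x * s y) := by ring

/-- The associativity constraint `(E ⊗̂ F) ⊗̂ G → E ⊗̂ (F ⊗̂ G)`, `(x ⊗ y) ⊗ w ↦ x ⊗ (y ⊗ w)`. -/
def CTensor.assoc : CTensor (CTensor E F) G →L[ℂ] CTensor E (CTensor F G) :=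
  CTensor.lift (CTensor.assocBilin E F G) (CTensor.continuous_assocBilin E F G)

@[simp]
theorem CTensor.assoc_mk (x : E) (y : F) (w : G) :
    CTensor.assoc E F G (CTensor.mk (CTensor E F) G (CTensor.mk E F x y) w) =
      CTensor.mk E (CTensor F G) x (CTensor.mk F G y w) := by
  rw [CTensor.assoc, CTensor.lift_mk, CTensor.assocBilin_mk]

end Assoc

section Unit

variable (E : Type*) [AddCommGroup E] [Module ℂ E] [UniformSpace E] [IsUniformAddGroup E]
  [PolynormableSpace ℂ E] [ContinuousSMul ℂ E] [CompleteSpace E] [T0Space E]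

/-- The left unit constraint `ℂ ⊗̂ E → E`, `c ⊗ x ↦ c • x`. -/
def CTensor.lid : CTensor ℂ E →L[ℂ] E :=
  haveI := uniformContinuousConstSMul_of_continuousConstSMul ℂ E
  CTensor.lift (LinearMap.lsmul ℂ E) continuous_smul

/-- The right unit constraint `E ⊗̂ ℂ → E`, `x ⊗ c ↦ c • x`. -/
def CTensor.rid : CTensor E ℂ →L[ℂ] E :=
  haveI := uniformContinuousConstSMul_of_continuousConstSMul ℂ E
  CTensor.lift (LinearMap.lsmul ℂ E).flip (continuous_snd.smul continuous_fst)

@[simp]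
theorem CTensor.lid_mk (c : ℂ) (x : E) : CTensor.lid E (CTensor.mk ℂ E c x) = c • x :=
  haveI := uniformContinuousConstSMul_of_continuousConstSMul ℂ E
  CTensor.lift_mk _ _ _ _

@[simp]
theorem CTensor.rid_mk (c : ℂ) (x : E) : CTensor.rid E (CTensor.mk E ℂ x c) = c • x :=
  haveI := uniformContinuousConstSMul_of_continuousConstSMul ℂ E
  CTensor.lift_mk _ _ _ _

end Unit

section Algebra

variable (A : Type*) [Ring A] [Algebra ℂ A] (B : Type*) [Ring B] [Algebra ℂ B]

instance : Ring (ProjTensor A B) := inferInstanceAs (Ring (A ⊗[ℂ] B))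
instance : Algebra ℂ (ProjTensor A B) := inferInstanceAs (Algebra ℂ (A ⊗[ℂ] B))

theorem ProjTensor.mk_mul_mk (a a' : A) (b b' : B) :
    ProjTensor.mk A B a b * ProjTensor.mk A B a' b' = ProjTensor.mk A B (a * a') (b * b') :=
  Algebra.TensorProduct.tmul_mul_tmul a a' b b'

variable [TopologicalSpace A] [IsTopologicalRing A] [PolynormableSpace ℂ A]
variable [TopologicalSpace B] [IsTopologicalRing B] [PolynormableSpace ℂ B]

/-- The multiplication of `A ⊗ B` is jointly continuous. -/
instance : IsTopologicalRing (ProjTensor A B) where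
  continuous_mul := by
    refine continuous_of_exists_bound (ProjTensor.withSeminorms A B)
      (LinearMap.mul ℂ (ProjTensor A B)) ?_
    rintro ⟨p, r, s, hr, hs, hp⟩
    obtain ⟨r₁, r₂, hr₁, hr₂, h1⟩ := exists_bound_of_continuous (LinearMap.mul ℂ A) r
      (hr.comp continuous_mul)
    obtain ⟨s₁, s₂, hs₁, hs₂, h2⟩ := exists_bound_of_continuous (LinearMap.mul ℂ B) s
      (hs.comp continuous_mul)
    obtain ⟨P, hP, hPmax⟩ := ProjTensor.exists_seminorm hr₁ hs₁
    obtain ⟨Q, hQ, hQmax⟩ := ProjTensor.exists_seminorm hr₂ hs₂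
    refine ⟨P, Q, hP, hQ, fun x y => ?_⟩
    refine hQmax (p.comp (LinearMap.mul ℂ (ProjTensor A B) x)) (P x) (apply_nonneg P x)
      (fun a' b' => ?_) y
    rw [mul_comm]
    refine hPmax (p.comp ((LinearMap.mul ℂ (ProjTensor A B)).flip (ProjTensor.mk A B a' b')))
      (r₂ a' * s₂ b') (mul_nonneg (apply_nonneg _ _) (apply_nonneg _ _)) (fun a b => ?_) x
    calc p (ProjTensor.mk A B a b * ProjTensor.mk A B a' b')
        = p (ProjTensor.mk A B (a * a') (b * b')) := by rw [ProjTensor.mk_mul_mk]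
      _ ≤ r (a * a') * s (b * b') := hp _ _
      _ ≤ (r₁ a * r₂ a') * (s₁ b * s₂ b') :=
          mul_le_mul (h1 a a') (h2 b b') (apply_nonneg _ _)
            (mul_nonneg (apply_nonneg _ _) (apply_nonneg _ _))
      _ = r₂ a' * s₂ b' * (r₁ a * s₁ b) := by ring


theorem CTensor.mk_mul_mk (a a' : A) (b b' : B) :
    CTensor.mk A B a b * CTensor.mk A B a' b' = CTensor.mk A B (a * a') (b * b') := by
  simp only [CTensor.mk_apply]
  rw [← Completion.coe_mul, ProjTensor.mk_mul_mk]

end Algebra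

section Mul
variable (A : Type*) [Ring A] [Algebra ℂ A] [UniformSpace A] [IsUniformAddGroup A]
  [IsTopologicalRing A] [PolynormableSpace ℂ A] [CompleteSpace A] [T0Space A]

/-- The multiplication `A ⊗̂ A → A`, `a ⊗ b ↦ a * b`, of a complete topological algebra. -/
def CTensor.mul' : CTensor A A →L[ℂ] A :=
  haveI := uniformContinuousConstSMul_of_continuousConstSMul ℂ A
  CTensor.lift (LinearMap.mul ℂ A) continuous_mul

@[simp]
theorem CTensor.mul'_mk (a b : A) : CTensor.mul' A (CTensor.mk A A a b) = a * b :=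
  haveI := uniformContinuousConstSMul_of_continuousConstSMul ℂ A
  CTensor.lift_mk _ _ _ _

end Mul

end ProjectiveTensor

section Envelope

/-- An algebra `A`, to be endowed with the topology determined by all submultiplicative
seminorms. -/
def SubmulTop (A : Type*) := A

variable (A : Type*) [Ring A] [Algebra ℂ A]

instance : Ring (SubmulTop A) := inferInstanceAs (Ring A)
instance : Algebra ℂ (SubmulTop A) := inferInstanceAs (Algebra ℂ A)

/-- A seminorm `p` is submultiplicative if `p (a * b) ≤ p a * p b` for all `a`, `b`. -/
def IsSubmul {A : Type*} [Ring A] [Algebra ℂ A] (p : Seminorm ℂ A) : Prop :=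
  ∀ a b, p (a * b) ≤ p a * p b

/-- The uniform structure of the topology determined by all submultiplicative seminorms. -/
instance : UniformSpace (SubmulTop A) :=
  ⨅ p : {p : Seminorm ℂ (SubmulTop A) // IsSubmul p}, p.1.toSeminormedAddCommGroup.toUniformSpace

instance : IsUniformAddGroup (SubmulTop A) :=
  isUniformAddGroup_iInf fun p =>
    letI := p.1.toSeminormedAddCommGroup
    inferInstance

theorem SubmulTop.withSeminorms :
    WithSeminorms (fun p : {p : Seminorm ℂ (SubmulTop A) // IsSubmul p} => p.1) :=
  (SeminormFamily.withSeminorms_iff_uniformSpace_eq_iInf _).2 rfl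

instance : PolynormableSpace ℂ (SubmulTop A) := (SubmulTop.withSeminorms A).toPolynormableSpace

instance : ContinuousSMul ℂ (SubmulTop A) := (SubmulTop.withSeminorms A).continuousSMul

instance : UniformContinuousConstSMul ℂ (SubmulTop A) :=
  uniformContinuousConstSMul_of_continuousConstSMul _ _

instance : IsTopologicalRing (SubmulTop A) where
  continuous_mul :=
    continuous_of_exists_bound (SubmulTop.withSeminorms A) (LinearMap.mul ℂ (SubmulTop A))
      fun p => ⟨p.1, p.1, (SubmulTop.withSeminorms A).continuous_seminorm p,
        (SubmulTop.withSeminorms A).continuous_seminorm p, p.2⟩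

/-- The Arens-Michael envelope of an abstract algebra `A` (that is, of `A` with its strongest
locally convex topology): the completion with respect to all submultiplicative seminorms. -/
abbrev AMEnvelope : Type _ := Completion (SubmulTop A)

end Envelope

section FreeEntire

/-- The algebra `𝓕ₙ` of free entire functions: the Arens-Michael envelope of the free algebra in
`n` generators. -/
abbrev FreeEntire (n : ℕ) : Type := AMEnvelope (FreeAlgebra ℂ (Fin n))

/-- The canonical homomorphism of an algebra to its Arens-Michael envelope. -/
def AMEnvelope.of (A : Type*) [Ring A] [Algebra ℂ A] (a : A) : AMEnvelope A :=
  Completion.coe' (show SubmulTop A from a)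

/-- The generators `ζ₁, …, ζₙ` of `𝓕ₙ`. -/
def FreeEntire.gen {n : ℕ} (i : Fin n) : FreeEntire n :=
  AMEnvelope.of (FreeAlgebra ℂ (Fin n)) (FreeAlgebra.ι ℂ i)

/-- The submultiplicative seminorms on the free algebra that are at most `k` on `1` and on the
generators. -/
def wordSet (n k : ℕ) : Set (Seminorm ℂ (SubmulTop (FreeAlgebra ℂ (Fin n)))) :=
  {p | IsSubmul p ∧ p (1 : FreeAlgebra ℂ (Fin n)) ≤ k ∧
    ∀ i, p (FreeAlgebra.ι ℂ i : FreeAlgebra ℂ (Fin n)) ≤ k}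

theorem bddAbove_wordSet (n k : ℕ) : BddAbove (wordSet n k) := by
  have hb : ∀ z : FreeAlgebra ℂ (Fin n), ∃ C : ℝ, 0 ≤ C ∧ ∀ p ∈ wordSet n k, p z ≤ C := by
    intro z
    induction z using FreeAlgebra.induction with
    | grade0 c =>
      refine ⟨‖c‖ * k, by positivity, fun p hp => ?_⟩
      rw [Algebra.algebraMap_eq_smul_one]
      exact (map_smul_eq_mul p c (1 : SubmulTop (FreeAlgebra ℂ (Fin n)))).trans_le
        (mul_le_mul_of_nonneg_left hp.2.1 (norm_nonneg c))
    | grade1 i => exact ⟨k, by positivity, fun p hp => hp.2.2 i⟩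
    | mul a b ha hb =>
      obtain ⟨C, hC, ha⟩ := ha
      obtain ⟨D, hD, hb⟩ := hb
      exact ⟨C * D, mul_nonneg hC hD, fun p hp => (hp.1 a b).trans
        (mul_le_mul (ha p hp) (hb p hp) (apply_nonneg _ _) hC)⟩
    | add a b ha hb =>
      obtain ⟨C, hC, ha⟩ := ha
      obtain ⟨D, hD, hb⟩ := hb
      exact ⟨C + D, add_nonneg hC hD, fun p hp =>
        (map_add_le_add p (a : SubmulTop (FreeAlgebra ℂ (Fin n))) b).trans
          (add_le_add (ha p hp) (hb p hp))⟩
  choose C hC using hb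
  rw [Seminorm.bddAbove_iff]
  exact ⟨C, by rintro _ ⟨q, hq, rfl⟩ z; exact (hC z).2 q hq⟩

/-- The largest submultiplicative seminorm that is at most `k` on `1` and on the generators. -/
def wordSeminorm (n k : ℕ) : Seminorm ℂ (SubmulTop (FreeAlgebra ℂ (Fin n))) :=
  sSup (wordSet n k)

theorem isSubmul_wordSeminorm (n k : ℕ) : IsSubmul (wordSeminorm n k) := by
  intro a b
  have hne : (wordSet n k).Nonempty :=
    ⟨0, fun a b => by simp, Nat.cast_nonneg k, fun i => Nat.cast_nonneg k⟩
  have : Nonempty (wordSet n k) := hne.to_subtype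
  have hle : ∀ p ∈ wordSet n k, ∀ z, p z ≤ wordSeminorm n k z :=
    fun p hp z => le_csSup (bddAbove_wordSet n k) hp z
  rw [wordSeminorm, Seminorm.sSup_apply (bddAbove_wordSet n k)]
  exact ciSup_le fun p => (p.2.1 a b).trans
    (mul_le_mul (hle _ p.2 a) (hle _ p.2 b) (apply_nonneg _ _) (apply_nonneg _ _))

theorem withSeminorms_wordSeminorm (n : ℕ) : WithSeminorms (wordSeminorm n) := by
  have hw := SubmulTop.withSeminorms (FreeAlgebra ℂ (Fin n))
  rw [SeminormFamily.withSeminorms_iff_nhds_eq_iInf] at hw ⊢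
  refine le_antisymm (le_iInf fun k => ?_) ?_
  · rw [hw]
    exact iInf_le (fun p : {p : Seminorm ℂ (SubmulTop (FreeAlgebra ℂ (Fin n))) // IsSubmul p} =>
      (𝓝 0).comap p.1) ⟨wordSeminorm n k, isSubmul_wordSeminorm n k⟩
  · rw [hw]
    refine le_iInf fun p => ?_
    obtain ⟨k, hk⟩ : ∃ k : ℕ, p.1 ∈ wordSet n k := by
      obtain ⟨k₀, hk₀⟩ := exists_nat_ge (p.1 (1 : FreeAlgebra ℂ (Fin n)))
      choose m hm using fun i : Fin n =>
        exists_nat_ge (p.1 (FreeAlgebra.ι ℂ i : FreeAlgebra ℂ (Fin n)))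
      refine ⟨k₀ + ∑ i, m i, p.2, hk₀.trans (by exact_mod_cast Nat.le_add_right _ _),
        fun i => (hm i).trans ?_⟩
      exact_mod_cast (Finset.single_le_sum (fun _ _ => Nat.zero_le _) (Finset.mem_univ i)).trans
        (Nat.le_add_left _ _)
    refine (iInf_le _ k).trans (Filter.tendsto_iff_comap.1 ?_)
    exact squeeze_zero (fun z => apply_nonneg _ _)
      (fun z => le_csSup (bddAbove_wordSet n k) hk z) Filter.tendsto_comap

instance (n : ℕ) : FirstCountableTopology (SubmulTop (FreeAlgebra ℂ (Fin n))) :=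
  (withSeminorms_wordSeminorm n).firstCountableTopology

theorem firstCountable_completion (E : Type*) [AddCommGroup E] [UniformSpace E]
    [IsUniformAddGroup E] [FirstCountableTopology E] : FirstCountableTopology (Completion E) := by
  obtain ⟨s, hs⟩ := (𝓝 (0 : E)).exists_antitone_basis
  have hb : (𝓝 (0 : Completion E)).HasBasis (fun _ : ℕ => True)
      fun k => closure (((↑) : E → Completion E) '' s k) := by
    refine ⟨fun t => ⟨fun ht => ?_, fun ⟨k, _, hk⟩ => Filter.mem_of_superset ?_ hk⟩⟩
    · obtain ⟨V, hV, hVc, hVt⟩ := exists_mem_nhds_isClosed_subset ht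
      have hV' : ((↑) : E → Completion E) ⁻¹' V ∈ 𝓝 (0 : E) :=
        (Completion.continuous_coe E).continuousAt.preimage_mem_nhds (by rwa [Completion.coe_zero])
      obtain ⟨k, -, hk⟩ := hs.1.mem_iff.1 hV'
      exact ⟨k, trivial, (hVc.closure_subset_iff.2 (Set.image_subset_iff.2 hk)).trans hVt⟩
    · rw [← Completion.coe_zero]
      exact Completion.isDenseInducing_coe.closure_image_mem_nhds (hs.1.mem_of_mem trivial)
  have : (𝓝 (0 : Completion E)).IsCountablyGenerated := hb.isCountablyGenerated
  have : (uniformity (Completion E)).IsCountablyGenerated :=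
    IsUniformAddGroup.uniformity_countably_generated
  exact UniformSpace.firstCountableTopology _

instance (n : ℕ) : FirstCountableTopology (FreeEntire n) := firstCountable_completion _

end FreeEntire

section Quotient

variable {A : Type*} [Ring A] [UniformSpace A]

/-- The closed two-sided ideal generated by a set. -/
def closedIdeal (s : Set A) : Ideal A :=
  sInf {J : Ideal A | J.IsTwoSided ∧ IsClosed (J : Set A) ∧ s ⊆ J}

instance (s : Set A) : (closedIdeal s).IsTwoSided where
  mul_mem_of_left b ha := by
    simp only [closedIdeal, Submodule.mem_sInf] at ha ⊢
    intro J hJ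
    have := hJ.1
    exact Ideal.mul_mem_right b J (ha J hJ)

instance isClosed_closedIdeal (s : Set A) : IsClosed (closedIdeal s : Set A) := by
  rw [closedIdeal, Submodule.coe_sInf]
  exact isClosed_biInter fun J hJ => hJ.2.1

/-- The quotient of a topological algebra by the closed two-sided ideal generated by a set of
relations. -/
def ClosedQuot (s : Set A) := A ⧸ closedIdeal s

instance (s : Set A) : Ring (ClosedQuot s) := inferInstanceAs (Ring (A ⧸ closedIdeal s))

instance (s : Set A) [Algebra ℂ A] : Algebra ℂ (ClosedQuot s) :=
  inferInstanceAs (Algebra ℂ (A ⧸ closedIdeal s))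

/-- The quotient map. -/
def ClosedQuot.mk (s : Set A) : A →+* ClosedQuot s := Ideal.Quotient.mk (closedIdeal s)

variable [IsUniformAddGroup A]

/-- The uniform structure of the quotient topology. -/
instance (s : Set A) : UniformSpace (ClosedQuot s) :=
  IsTopologicalAddGroup.rightUniformSpace (A ⧸ closedIdeal s)

instance (s : Set A) : IsUniformAddGroup (ClosedQuot s) :=
  @isUniformAddGroup_of_addCommGroup (A ⧸ closedIdeal s) _ _ _

theorem ClosedQuot.isOpenQuotientMap_mk (s : Set A) : IsOpenQuotientMap (ClosedQuot.mk s) :=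
  QuotientAddGroup.isOpenQuotientMap_mk

instance (s : Set A) : T2Space (ClosedQuot s) :=
  inferInstanceAs (T2Space (A ⧸ closedIdeal s))

instance (s : Set A) [FirstCountableTopology A] : FirstCountableTopology (ClosedQuot s) :=
  inferInstanceAs (FirstCountableTopology (A ⧸ (closedIdeal s).toAddSubgroup))

instance (s : Set A) [FirstCountableTopology A] [CompleteSpace A] : CompleteSpace (ClosedQuot s) :=
  QuotientAddGroup.completeSpace_right A (closedIdeal s).toAddSubgroup

instance (s : Set A) [IsTopologicalRing A] : IsTopologicalRing (ClosedQuot s) where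
  continuous_mul := by
    have h := ClosedQuot.isOpenQuotientMap_mk s
    rw [← (h.prodMap h).continuous_comp_iff]
    exact h.continuous.comp continuous_mul

variable [Algebra ℂ A]

instance (s : Set A) [ContinuousSMul ℂ A] : ContinuousSMul ℂ (ClosedQuot s) where
  continuous_smul := by
    have h := ClosedQuot.isOpenQuotientMap_mk s
    rw [← (IsOpenQuotientMap.id.prodMap h).continuous_comp_iff]
    exact h.continuous.comp continuous_smul

open scoped ComplexOrder in
instance (s : Set A) [PolynormableSpace ℂ A] : PolynormableSpace ℂ (ClosedQuot s) := by
  have hw := PolynormableSpace.withSeminorms ℂ A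
  have : ContinuousSMul ℂ A := hw.continuousSMul
  have : LocallyConvexSpace ℝ A := hw.toLocallyConvexSpace
  have : LocallyConvexSpace ℂ (ClosedQuot s) := by
    refine LocallyConvexSpace.ofBasisZero ℂ (ClosedQuot s) (fun U => U)
      (fun U : Set (ClosedQuot s) => U ∈ 𝓝 0 ∧ Convex ℂ U) ?_ (fun U hU => hU.2)
    refine ⟨fun t => ⟨fun ht => ?_, fun ⟨U, hU, hUt⟩ => Filter.mem_of_superset hU.1 hUt⟩⟩
    have h := ClosedQuot.isOpenQuotientMap_mk s
    have ht' : ClosedQuot.mk s ⁻¹' t ∈ 𝓝 (0 : A) :=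
      h.continuous.continuousAt.preimage_mem_nhds (by rwa [map_zero])
    obtain ⟨U, ⟨hU, hUc⟩, hUt⟩ := (LocallyConvexSpace.convex_basis_zero ℝ A).mem_iff.1 ht'
    refine ⟨ClosedQuot.mk s '' U, ⟨?_, ?_⟩, Set.image_subset_iff.2 hUt⟩
    · rw [← map_zero (ClosedQuot.mk s)]
      exact h.isOpenMap.image_mem_nhds hU
    · exact convex_of_nonneg_surjective_algebraMap _
        (fun c hc => by
          obtain ⟨x, hx, h⟩ := RCLike.nonneg_iff_exists_ofReal.mp (Set.mem_Ici.1 hc)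
          exact ⟨x, hx, h⟩)
        (hUc.is_linear_image (f := ClosedQuot.mk s) ⟨map_add _, fun c x => rfl⟩)
  have : ContinuousSMul ℝ (ClosedQuot s) := IsScalarTower.continuousSMul ℂ
  infer_instance

end Quotient

section Definitions

/-- Arens-Michael algebras: complete Hausdorff topological algebras whose topology is determined by
a system of submultiplicative seminorms. -/
structure IsArensMichael (A : Type*) [Ring A] [Algebra ℂ A] [UniformSpace A] : Prop where
  isUniformAddGroup : IsUniformAddGroup A
  completeSpace : CompleteSpace A
  t2Space : T2Space A
  exists_seminorms : ∃ s : Set (Seminorm ℂ A), (∀ p ∈ s, IsSubmul p) ∧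
    WithSeminorms (fun p : s => (p : Seminorm ℂ A))

/-- Holomorphically finitely generated algebras: Fréchet (i.e. metrizable) Arens-Michael algebras
`A` with finitely many elements `φ ζ₁, …, φ ζₙ` such that each element of `A` is a free entire
function of them, that is, the value at some `f ∈ 𝓕ₙ` of the evaluation homomorphism
`φ : 𝓕ₙ → A`. -/
structure IsHFG (A : Type*) [Ring A] [Algebra ℂ A] [UniformSpace A] : Prop
    extends IsArensMichael A where
  metrizableSpace : TopologicalSpace.MetrizableSpace A
  exists_generators : ∃ (n : ℕ) (φ : FreeEntire n →A[ℂ] A), Function.Surjective φ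

/-- The exponential `e ^ a = ∑ aⁿ / n!` in a topological algebra. -/
def aexp {A : Type*} [Ring A] [Algebra ℂ A] [TopologicalSpace A] (a : A) : A :=
  ∑' n : ℕ, ((n.factorial : ℂ)⁻¹) • a ^ n

/-- The hyperbolic sine `(e ^ a - e ^ (-a)) / 2` in a topological algebra. -/
def asinh {A : Type*} [Ring A] [Algebra ℂ A] [TopologicalSpace A] (a : A) : A :=
  (2 : ℂ)⁻¹ • (aexp a - aexp (-a))

/-- Hopf `⊗̂`-algebras: the Hopf algebra axioms in the category of complete Hausdorff locally convex
spaces with the complete projective tensor product, for a complete topological algebra `A`, a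
comultiplication `Δ` and a counit `ε` (continuous unital homomorphisms) and an antipode `S`. -/
structure IsHopfCTensor (A : Type*) [Ring A] [Algebra ℂ A] [UniformSpace A] [IsUniformAddGroup A]
    [IsTopologicalRing A] [ContinuousSMul ℂ A] [PolynormableSpace ℂ A] [CompleteSpace A]
    [T2Space A] (Δ : A →A[ℂ] CTensor A A) (ε : A →A[ℂ] ℂ) (S : A →L[ℂ] A) : Prop where
  coassoc : ∀ a, CTensor.assoc A A A
      (CTensor.map Δ.toContinuousLinearMap (ContinuousLinearMap.id ℂ A) (Δ a)) =
    CTensor.map (ContinuousLinearMap.id ℂ A) Δ.toContinuousLinearMap (Δ a)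
  counit_left : ∀ a, CTensor.lid A
    (CTensor.map ε.toContinuousLinearMap (ContinuousLinearMap.id ℂ A) (Δ a)) = a
  counit_right : ∀ a, CTensor.rid A
    (CTensor.map (ContinuousLinearMap.id ℂ A) ε.toContinuousLinearMap (Δ a)) = a
  antipode_left : ∀ a, CTensor.mul' A
    (CTensor.map S (ContinuousLinearMap.id ℂ A) (Δ a)) = algebraMap ℂ A (ε a)
  antipode_right : ∀ a, CTensor.mul' A
    (CTensor.map (ContinuousLinearMap.id ℂ A) S (Δ a)) = algebraMap ℂ A (ε a)

/-- The relations `[h, e] = 2e`, `[h, f] = -2f`, `[e, f] = sinh (ħ h) / sinh ħ`. -/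
structure Sl2Relations (ħ : ℂ) {A : Type*} [Ring A] [Algebra ℂ A] [TopologicalSpace A]
    (e f h : A) : Prop where
  he : h * e - e * h = (2 : ℂ) • e
  hf : h * f - f * h = -((2 : ℂ) • f)
  ef : e * f - f * e = (Complex.sinh ħ)⁻¹ • asinh (ħ • h)

/-- The elements of `𝓕₃`, with generators `E = ζ₁`, `F = ζ₂`, `H = ζ₃`, whose vanishing expresses
the relations of `Ũ(sl₂)_ħ`. -/
def sl2Relators (ħ : ℂ) : Set (FreeEntire 3) :=
  let E : FreeEntire 3 := FreeEntire.gen 0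
  let F : FreeEntire 3 := FreeEntire.gen 1
  let H : FreeEntire 3 := FreeEntire.gen 2
  {H * E - E * H - (2 : ℂ) • E,
   H * F - F * H + (2 : ℂ) • F,
   E * F - F * E - (Complex.sinh ħ)⁻¹ • asinh (ħ • H)}

/-- The algebra `Ũ(sl₂)_ħ`: the quotient of the algebra of free entire functions in `E`, `F`, `H` by
the closed two-sided ideal generated by the relations. -/
abbrev USl2 (ħ : ℂ) : Type := ClosedQuot (sl2Relators ħ)

/-- The generator `E` of `Ũ(sl₂)_ħ`. -/
def USl2.E (ħ : ℂ) : USl2 ħ := ClosedQuot.mk (sl2Relators ħ) (FreeEntire.gen 0)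

/-- The generator `F` of `Ũ(sl₂)_ħ`. -/
def USl2.F (ħ : ℂ) : USl2 ħ := ClosedQuot.mk (sl2Relators ħ) (FreeEntire.gen 1)

/-- The generator `H` of `Ũ(sl₂)_ħ`. -/
def USl2.H (ħ : ℂ) : USl2 ħ := ClosedQuot.mk (sl2Relators ħ) (FreeEntire.gen 2)

end Definitions

end
end HFG

open HFG

/-!
The algebra `Ũ(sl₂)_ħ` is a quotient of the algebra of free entire functions, so a continuous
homomorphism from it to an Arens–Michael algebra is the same thing as a triple of elements that
satisfies the relations (`USl2.lift`, `USl2.hom_ext`). All structure maps are obtained from this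
universal property. The comultiplication needs that `A ⊗̂ A` is again an Arens–Michael algebra; the
antipode is a homomorphism to the opposite algebra. Arens–Michael algebras are handled through the
class `LocallyMConvex`, which passes to quotients, completions, projective tensor products and
opposite algebras.

That the prescribed images of the generators satisfy the relations (`Sl2Relations.comul`,
`Sl2Relations.antipode`) rests on two facts about the exponential in an Arens–Michael algebra:
`e ^ (a + b) = e ^ a * e ^ b` if `a` and `b` commute (`aexp_add_of_commute`), whence
`Δ (e ^ (ħ H)) = e ^ (ħ H) ⊗ e ^ (ħ H)`, and `e ^ (t h) x = e ^ (t c) x e ^ (t h)` if `[h, x] = c x`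
(`aexp_smul_mul`), which makes the unwanted cross terms cancel.

Coassociativity and the counit axioms compare continuous homomorphisms and so may be checked on the
generators. The maps in the antipode axioms are not homomorphisms, but the elements at which these
axioms hold form a closed subalgebra (`CTensor.mul'_map_mul_left`, `CTensor.mul'_map_mul_right`).
The square of the antipode is the automorphism `E ↦ e ^ (2ħ) E`, `F ↦ e ^ (-2ħ) F`, `H ↦ H`, so the
antipode is invertible. Finally, the characters that kill `E` and `F` and send `H` to a zero of
`z ↦ sinh (ħ z)` show that `H` is transcendental, so the algebra is infinite-dimensional.
-/

namespace HFG
noncomputable section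

/-! ### Locally multiplicatively convex algebras -/

/-- A topological algebra is locally `m`-convex if the open unit balls of its continuous
submultiplicative seminorms form a neighbourhood basis of `0`. -/
class LocallyMConvex (A : Type*) [Ring A] [Algebra ℂ A] [TopologicalSpace A] : Prop where
  exists_submul : ∀ U ∈ 𝓝 (0 : A),
    ∃ p : Seminorm ℂ A, Continuous p ∧ IsSubmul p ∧ ∀ x, p x < 1 → x ∈ U

/-- Every continuous seminorm is dominated by a continuous submultiplicative one. -/
theorem LocallyMConvex.exists_le {A : Type*} [Ring A] [Algebra ℂ A] [TopologicalSpace A]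
    [LocallyMConvex A] {r : Seminorm ℂ A} (hr : Continuous r) :
    ∃ p : Seminorm ℂ A, Continuous p ∧ IsSubmul p ∧ ∀ x, r x ≤ p x := by
  obtain ⟨p, hp, hs, h⟩ := LocallyMConvex.exists_submul {x : A | r x < 1}
    ((isOpen_lt hr continuous_const).mem_nhds (by simp))
  refine ⟨p, hp, hs, fun x => le_of_forall_pos_le_add fun δ hδ => ?_⟩
  have hc : 0 < p x + δ := add_pos_of_nonneg_of_pos (apply_nonneg p x) hδ
  have hn : ‖((p x + δ : ℝ) : ℂ)⁻¹‖ = (p x + δ)⁻¹ := by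
    rw [norm_inv, Complex.norm_real, Real.norm_of_nonneg hc.le]
  have h1 : r (((p x + δ : ℝ) : ℂ)⁻¹ • x) < 1 := h _ <| by
    rw [map_smul_eq_mul, hn, inv_mul_lt_iff₀ hc]
    linarith
  rw [map_smul_eq_mul, hn, inv_mul_lt_iff₀ hc] at h1
  linarith

theorem LocallyMConvex.withSeminorms (A : Type*) [Ring A] [Algebra ℂ A] [TopologicalSpace A]
    [IsTopologicalAddGroup A] [LocallyMConvex A] :
    WithSeminorms (fun p : {p : Seminorm ℂ A | Continuous p ∧ IsSubmul p} =>
      (p : Seminorm ℂ A)) := by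
  rw [SeminormFamily.withSeminorms_iff_nhds_eq_iInf]
  refine le_antisymm ?_ fun U hU => ?_
  · simp_rw [le_iInf_iff, ← Filter.tendsto_iff_comap]
    rintro ⟨p, hp⟩
    exact hp.1.tendsto' 0 0 (map_zero _)
  · obtain ⟨p, hp, hs, h⟩ := LocallyMConvex.exists_submul U hU
    refine Filter.mem_iInf_of_mem ⟨p, hp, hs⟩ ?_
    exact Filter.mem_of_superset (Filter.preimage_mem_comap (Iio_mem_nhds one_pos)) h

theorem LocallyMConvex.isArensMichael {A : Type*} [Ring A] [Algebra ℂ A] [UniformSpace A]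
    [IsUniformAddGroup A] [CompleteSpace A] [T2Space A] [LocallyMConvex A] : IsArensMichael A :=
  ⟨inferInstance, inferInstance, inferInstance, _, fun _ hp => hp.2,
    LocallyMConvex.withSeminorms A⟩

theorem LocallyMConvex.of_withSeminorms {A ι : Type*} [Ring A] [Algebra ℂ A] [TopologicalSpace A]
    {p : SeminormFamily ℂ A ι} (hp : WithSeminorms p) (hs : ∀ i, IsSubmul (p i)) :
    LocallyMConvex A := by
  refine ⟨fun U hU => ?_⟩
  obtain ⟨⟨t, ε⟩, hε, ht⟩ := hp.hasBasis_zero_ball.mem_iff.1 hU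
  have : IsTopologicalAddGroup A := hp.topologicalAddGroup
  let P : Seminorm ℂ A := t.sup p
  have hsup : Continuous P := Seminorm.continuous_finsetSup fun i _ =>
    hp.continuous_seminorm i
  have hsub : IsSubmul P := fun a b => by
    refine Seminorm.finset_sup_apply_le (by positivity) fun i hi => (hs i a b).trans ?_
    exact mul_le_mul (Seminorm.le_finset_sup_apply hi) (Seminorm.le_finset_sup_apply hi)
      (apply_nonneg _ _) (apply_nonneg _ _)
  -- Rescaling by a factor at least `1` preserves submultiplicativity and shrinks the unit ball.
  let c : NNReal := ⟨max 1 ε⁻¹, by positivity⟩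
  refine ⟨c • P, hsup.const_smul c, fun a b => ?_, fun x hx => ht ?_⟩
  · change max 1 ε⁻¹ * P (a * b) ≤ max 1 ε⁻¹ * P a * (max 1 ε⁻¹ * P b)
    have h1 : (1 : ℝ) ≤ max 1 ε⁻¹ := le_max_left _ _
    have h2 : 0 ≤ P a * P b := mul_nonneg (apply_nonneg _ _) (apply_nonneg _ _)
    calc max 1 ε⁻¹ * P (a * b) ≤ max 1 ε⁻¹ * (1 * (P a * P b)) := by
          rw [one_mul]
          exact mul_le_mul_of_nonneg_left (hsub a b) (by positivity)
      _ ≤ max 1 ε⁻¹ * (max 1 ε⁻¹ * (P a * P b)) := by gcongr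
      _ = _ := by ring
  · rw [Seminorm.mem_ball_zero]
    change max 1 ε⁻¹ * P x < 1 at hx
    have : ε⁻¹ * P x < 1 :=
      (mul_le_mul_of_nonneg_right (le_max_right _ _) (apply_nonneg _ _)).trans_lt hx
    rwa [inv_mul_lt_iff₀ hε, mul_one] at this

theorem IsArensMichael.locallyMConvex {A : Type*} [Ring A] [Algebra ℂ A] [UniformSpace A]
    (h : IsArensMichael A) : LocallyMConvex A :=
  let ⟨_, hs, hw⟩ := h.exists_seminorms
  LocallyMConvex.of_withSeminorms hw fun p => hs p.1 p.2

theorem IsArensMichael.isTopologicalRing {A : Type*} [Ring A] [Algebra ℂ A] [UniformSpace A]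
    (h : IsArensMichael A) : IsTopologicalRing A := by
  have := h.isUniformAddGroup
  obtain ⟨s, hs, hw⟩ := h.exists_seminorms
  exact { continuous_mul := continuous_of_exists_bound hw (LinearMap.mul ℂ A) fun p =>
    ⟨p.1, p.1, hw.continuous_seminorm p, hw.continuous_seminorm p, hs p.1 p.2⟩ }

instance (A : Type*) [Ring A] [Algebra ℂ A] : LocallyMConvex (SubmulTop A) :=
  LocallyMConvex.of_withSeminorms (SubmulTop.withSeminorms A) fun p => p.2

instance : LocallyMConvex ℂ :=
  LocallyMConvex.of_withSeminorms (norm_withSeminorms ℂ ℂ) fun _ a b => norm_mul_le a b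

instance (A : Type*) [Ring A] [Algebra ℂ A] [TopologicalSpace A] [LocallyMConvex A] :
    LocallyMConvex Aᵐᵒᵖ where
  exists_submul U hU := by
    obtain ⟨p, hp, hs, h⟩ := LocallyMConvex.exists_submul (MulOpposite.op ⁻¹' U)
      (MulOpposite.continuous_op.continuousAt.preimage_mem_nhds (by simpa using hU))
    refine ⟨p.comp (MulOpposite.opLinearEquiv ℂ).symm.toLinearMap,
      hp.comp MulOpposite.continuous_unop, fun a b => ?_, fun x hx => h x.unop hx⟩
    exact (hs b.unop a.unop).trans_eq (mul_comm _ _)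

instance (A : Type*) [AddCommGroup A] [UniformSpace A] [IsUniformAddGroup A] :
    IsUniformAddGroup Aᵐᵒᵖ where
  uniformContinuous_sub :=
    MulOpposite.uniformContinuous_op.comp
      ((MulOpposite.uniformContinuous_unop.comp uniformContinuous_fst).sub
        (MulOpposite.uniformContinuous_unop.comp uniformContinuous_snd))

instance (A : Type*) [Ring A] [Algebra ℂ A] [UniformSpace A] [IsUniformAddGroup A]
    [IsTopologicalRing A] [UniformContinuousConstSMul ℂ A] [LocallyMConvex A] :
    LocallyMConvex (Completion A) where
  exists_submul U hU := by
    obtain ⟨V, hV, hVc, hVU⟩ := exists_mem_nhds_isClosed_subset hU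
    have hV' : ((↑) : A → Completion A) ⁻¹' V ∈ 𝓝 (0 : A) :=
      (Completion.continuous_coe A).continuousAt.preimage_mem_nhds (by rwa [Completion.coe_zero])
    obtain ⟨p, hp, hs, hpV⟩ := LocallyMConvex.exists_submul _ hV'
    have hc := continuous_completionSeminorm p hp
    refine ⟨completionSeminorm p hp, hc, fun a b => ?_, fun x hx => hVU ?_⟩
    · refine Completion.induction_on₂ a b (isClosed_le (hc.comp continuous_mul)
        ((hc.comp continuous_fst).mul (hc.comp continuous_snd))) fun a b => ?_
      rw [← Completion.coe_mul]
      simp only [completionSeminorm_coe]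
      exact hs a b
    · refine hVc.closure_subset_iff.2 ?_
        (Completion.denseRange_coe.open_subset_closure_inter (isOpen_lt hc continuous_const) hx)
      rintro _ ⟨hy, a, rfl⟩
      exact hpV a (by simpa [completionSeminorm_coe] using hy)

/-- The projective tensor product of locally `m`-convex algebras is locally `m`-convex: the
projective tensor product of two submultiplicative seminorms, that is the largest seminorm
dominated by their product on elementary tensors, is submultiplicative. -/
instance (A B : Type*) [Ring A] [Algebra ℂ A] [TopologicalSpace A] [IsTopologicalRing A]
    [PolynormableSpace ℂ A] [LocallyMConvex A] [Ring B] [Algebra ℂ B] [TopologicalSpace B]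
    [IsTopologicalRing B] [PolynormableSpace ℂ B] [LocallyMConvex B] :
    LocallyMConvex (ProjTensor A B) where
  exists_submul U hU := by
    obtain ⟨p, hp, hpU⟩ := exists_seminorm_of_mem_nhds hU
    obtain ⟨r₀, s₀, hr₀, hs₀, hb⟩ := exists_bound_of_continuous (ProjTensor.mk A B) p
      (hp.comp (continuous_of_exists_bound (ProjTensor.withSeminorms A B) _ fun p => p.2))
    obtain ⟨r, hr, hrs, hrr⟩ := LocallyMConvex.exists_le hr₀
    obtain ⟨s, hs, hss, hsr⟩ := LocallyMConvex.exists_le hs₀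
    let S : Set (Seminorm ℂ (ProjTensor A B)) :=
      {q | ∀ x y, q (ProjTensor.mk A B x y) ≤ r x * s y}
    have hne : S.Nonempty := ⟨0, fun x y => mul_nonneg (apply_nonneg r x) (apply_nonneg s y)⟩
    obtain ⟨P, -, hPmax⟩ := ProjTensor.exists_seminorm hr hs
    have hS : BddAbove S := ⟨P, fun q hq z => by
      simpa using hPmax q 1 zero_le_one (fun x y => (hq x y).trans_eq (one_mul _).symm) z⟩
    have hle : ∀ q ∈ S, ∀ z, q z ≤ (sSup S) z := fun q hq z => le_csSup hS hq z
    have hQ : ∀ x y, (sSup S) (ProjTensor.mk A B x y) ≤ r x * s y := fun x y => by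
      rw [Seminorm.sSup_apply hS]
      have : Nonempty S := hne.to_subtype
      exact ciSup_le fun q => q.2 x y
    have hmax : ∀ (q : Seminorm ℂ (ProjTensor A B)) (C : ℝ), 0 ≤ C →
        (∀ x y, q (ProjTensor.mk A B x y) ≤ C * (r x * s y)) → ∀ z, q z ≤ C * (sSup S) z := by
      intro q C hC hq z
      rcases hC.eq_or_lt with rfl | hC
      · simpa using hPmax q 0 le_rfl hq z
      · let c : NNReal := ⟨C⁻¹, (inv_pos.2 hC).le⟩
        have h1 : C⁻¹ * q z ≤ _ := hle (c • q) (fun x y => by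
          change C⁻¹ * q _ ≤ _
          rw [inv_mul_le_iff₀ hC]
          exact hq x y) z
        rwa [inv_mul_le_iff₀ hC] at h1
    refine ⟨sSup S, ProjTensor.continuous_seminorm hr hs hQ, fun z w => ?_, fun x hx => hpU x ?_⟩
    · refine hmax ((sSup S).comp (LinearMap.mul ℂ (ProjTensor A B) z)) _ (apply_nonneg _ z)
        (fun a' b' => ?_) w
      rw [mul_comm]
      refine hmax ((sSup S).comp
        ((LinearMap.mul ℂ (ProjTensor A B)).flip (ProjTensor.mk A B a' b'))) _
        (mul_nonneg (apply_nonneg _ _) (apply_nonneg _ _)) (fun a b => ?_) z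
      calc sSup S (ProjTensor.mk A B a b * ProjTensor.mk A B a' b')
          = sSup S (ProjTensor.mk A B (a * a') (b * b')) := by rw [ProjTensor.mk_mul_mk]
        _ ≤ r (a * a') * s (b * b') := hQ _ _
        _ ≤ (r a * r a') * (s b * s b') := mul_le_mul (hrs _ _) (hss _ _) (apply_nonneg _ _)
            (mul_nonneg (apply_nonneg _ _) (apply_nonneg _ _))
        _ = r a' * s b' * (r a * s b) := by ring
    · refine (hle p (fun x y => (hb x y).trans ?_) x).trans_lt hx
      exact mul_le_mul (hrr x) (hsr y) (apply_nonneg _ _) (apply_nonneg _ _)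

section ClosedQuot

variable {A : Type*} [Ring A] [UniformSpace A]

theorem ClosedQuot.mk_surjective (s : Set A) : Function.Surjective (ClosedQuot.mk s) :=
  Ideal.Quotient.mk_surjective

theorem ClosedQuot.mk_eq_zero {s : Set A} {a : A} (ha : a ∈ s) : ClosedQuot.mk s a = 0 := by
  refine Ideal.Quotient.eq_zero_iff_mem.2 ?_
  simp only [closedIdeal, Submodule.mem_sInf]
  exact fun J hJ => hJ.2.2 ha

variable [Algebra ℂ A]

@[simp]
theorem ClosedQuot.mk_smul (s : Set A) (c : ℂ) (a : A) :
    ClosedQuot.mk s (c • a) = c • ClosedQuot.mk s a := rfl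

/-- The quotient seminorm `x ↦ inf {p a | mk a = x}`. -/
def ClosedQuot.seminorm (s : Set A) (p : Seminorm ℂ A) : Seminorm ℂ (ClosedQuot s) :=
  have hne : ∀ x, Nonempty {a // ClosedQuot.mk s a = x} := fun x =>
    let ⟨a, ha⟩ := ClosedQuot.mk_surjective s x
    ⟨a, ha⟩
  have hbdd : ∀ x, BddBelow (Set.range fun a : {a // ClosedQuot.mk s a = x} => p a) := fun x =>
    ⟨0, by rintro _ ⟨a, rfl⟩; exact apply_nonneg p _⟩
  Seminorm.ofSMulLE (fun x => ⨅ a : {a // ClosedQuot.mk s a = x}, p a)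
    (le_antisymm ((ciInf_le (hbdd 0) ⟨0, map_zero _⟩).trans_eq (map_zero p))
      (Real.iInf_nonneg fun a => apply_nonneg p _))
    (fun x y => le_ciInf_add_ciInf fun a b =>
      (ciInf_le (hbdd (x + y)) ⟨a.1 + b.1, by rw [map_add, a.2, b.2]⟩).trans
        (map_add_le_add p a.1 b.1))
    (fun c x => by
      rw [Real.mul_iInf_of_nonneg (norm_nonneg c)]
      exact le_ciInf fun a => (ciInf_le (hbdd (c • x)) ⟨c • a.1, by rw [mk_smul, a.2]⟩).trans_eq
        (map_smul_eq_mul p c a.1))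

theorem ClosedQuot.seminorm_mk_le (s : Set A) (p : Seminorm ℂ A) (a : A) :
    ClosedQuot.seminorm s p (ClosedQuot.mk s a) ≤ p a :=
  ciInf_le (f := fun b : {b // ClosedQuot.mk s b = ClosedQuot.mk s a} => p b)
    ⟨0, by rintro _ ⟨a, rfl⟩; exact apply_nonneg p _⟩ ⟨a, rfl⟩

theorem ClosedQuot.exists_of_seminorm_lt {s : Set A} {p : Seminorm ℂ A} {x : ClosedQuot s} {c : ℝ}
    (h : ClosedQuot.seminorm s p x < c) : ∃ a, ClosedQuot.mk s a = x ∧ p a < c := by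
  have : Nonempty {a // ClosedQuot.mk s a = x} :=
    let ⟨a, ha⟩ := ClosedQuot.mk_surjective s x
    ⟨a, ha⟩
  obtain ⟨⟨a, ha⟩, hac⟩ :=
    exists_lt_of_ciInf_lt (f := fun a : {a // ClosedQuot.mk s a = x} => p a) h
  exact ⟨a, ha, hac⟩

theorem ClosedQuot.isSubmul_seminorm (s : Set A) {p : Seminorm ℂ A} (hp : IsSubmul p) :
    IsSubmul (ClosedQuot.seminorm s p) := by
  intro x y
  have hlim : Filter.Tendsto
      (fun δ : ℝ => (ClosedQuot.seminorm s p x + δ) * (ClosedQuot.seminorm s p y + δ))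
      (𝓝[>] 0) (𝓝 (ClosedQuot.seminorm s p x * ClosedQuot.seminorm s p y)) := by
    have : Continuous fun δ : ℝ =>
        (ClosedQuot.seminorm s p x + δ) * (ClosedQuot.seminorm s p y + δ) := by fun_prop
    exact (this.tendsto' 0 _ (by simp)).mono_left nhdsWithin_le_nhds
  refine ge_of_tendsto hlim (Filter.eventually_of_mem self_mem_nhdsWithin fun δ hδ => ?_)
  obtain ⟨a, rfl, ha⟩ := exists_of_seminorm_lt (lt_add_of_pos_right (seminorm s p x) hδ)
  obtain ⟨b, rfl, hb⟩ := exists_of_seminorm_lt (lt_add_of_pos_right (seminorm s p y) hδ)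
  rw [← map_mul]
  exact ((seminorm_mk_le s p _).trans (hp a b)).trans
    (mul_le_mul ha.le hb.le (apply_nonneg _ _) ((apply_nonneg _ _).trans ha.le))

variable [IsUniformAddGroup A]

instance (s : Set A) [LocallyMConvex A] : LocallyMConvex (ClosedQuot s) where
  exists_submul U hU := by
    have hm := ClosedQuot.isOpenQuotientMap_mk s
    obtain ⟨p, hp, hs, h⟩ := LocallyMConvex.exists_submul (ClosedQuot.mk s ⁻¹' U)
      (hm.continuous.continuousAt.preimage_mem_nhds (by rwa [map_zero]))
    refine ⟨ClosedQuot.seminorm s p, ?_, ClosedQuot.isSubmul_seminorm s hs, fun x hx => ?_⟩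
    · refine Seminorm.continuous_of_continuousAt_zero ?_
      rw [ContinuousAt, map_zero, ← map_zero (ClosedQuot.mk s), ← hm.isOpenMap.map_nhds_eq
        hm.continuous.continuousAt, Filter.tendsto_map'_iff]
      exact squeeze_zero (fun a => apply_nonneg _ _) (ClosedQuot.seminorm_mk_le s p)
        (hp.tendsto' 0 0 (map_zero p))
    · obtain ⟨a, rfl, ha⟩ := ClosedQuot.exists_of_seminorm_lt hx
      exact h a ha

/-- The continuous homomorphism on a quotient induced by one that kills the relations. -/
def ClosedQuot.lift (s : Set A) {B : Type*} [Ring B] [Algebra ℂ B] [TopologicalSpace B] [T1Space B]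
    (φ : A →A[ℂ] B) (h : ∀ a ∈ s, φ a = 0) : ClosedQuot s →A[ℂ] B where
  toAlgHom := Ideal.Quotient.liftₐ (closedIdeal s) φ.toAlgHom fun a ha => by
    have hker : RingHom.ker φ.toAlgHom ∈
        {J : Ideal A | J.IsTwoSided ∧ IsClosed (J : Set A) ∧ s ⊆ J} :=
      ⟨inferInstance, isClosed_singleton.preimage φ.cont, h⟩
    exact sInf_le hker ha
  cont := (ClosedQuot.isOpenQuotientMap_mk s).continuous_comp_iff.1 φ.cont

/-- The quotient map as a continuous algebra homomorphism. -/
def ClosedQuot.mkA (s : Set A) : A →A[ℂ] ClosedQuot s where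
  toAlgHom := Ideal.Quotient.mkₐ ℂ (closedIdeal s)
  cont := (ClosedQuot.isOpenQuotientMap_mk s).continuous

end ClosedQuot

/-! ### Free entire functions -/

section FreeEntire

variable {B : Type*} [Ring B] [Algebra ℂ B] [UniformSpace B]

/-- Every homomorphism to a locally `m`-convex algebra is continuous for the topology determined by
all submultiplicative seminorms. -/
theorem SubmulTop.continuous_algHom {A B : Type*} [Ring A] [Algebra ℂ A] [Ring B] [Algebra ℂ B]
    [TopologicalSpace B] [IsTopologicalAddGroup B] [LocallyMConvex B] (ψ : SubmulTop A →ₐ[ℂ] B) :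
    Continuous ψ := by
  refine continuous_of_continuousAt_zero ψ fun U hU => ?_
  rw [map_zero] at hU
  obtain ⟨p, hp, hs, h⟩ := LocallyMConvex.exists_submul U hU
  have hs' : IsSubmul (p.comp ψ.toLinearMap) := fun a b =>
    (congrArg p (map_mul ψ a b)).trans_le (hs _ _)
  have hc : Continuous (p.comp ψ.toLinearMap) :=
    (SubmulTop.withSeminorms A).continuous_seminorm ⟨_, hs'⟩
  refine Filter.mem_of_superset ((isOpen_lt hc continuous_const).mem_nhds ?_) fun x hx => h _ hx
  simp

/-- The universal property of the Arens–Michael envelope. -/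
def AMEnvelope.lift {A : Type*} [Ring A] [Algebra ℂ A] [IsUniformAddGroup B] [IsTopologicalRing B]
    [CompleteSpace B] [T2Space B] [LocallyMConvex B] (φ : A →ₐ[ℂ] B) : AMEnvelope A →A[ℂ] B :=
  let ψ : SubmulTop A →ₐ[ℂ] B := φ
  have hψ : Continuous ψ := SubmulTop.continuous_algHom ψ
  { toAlgHom := AlgHom.mk (Completion.extensionHom ψ.toRingHom hψ) fun c =>
      (Completion.extensionHom_coe ψ.toRingHom hψ (algebraMap ℂ (SubmulTop A) c)).trans
        (ψ.commutes c)
    cont := Completion.continuous_extension }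

theorem AMEnvelope.lift_of {A : Type*} [Ring A] [Algebra ℂ A] [IsUniformAddGroup B]
    [IsTopologicalRing B] [CompleteSpace B] [T2Space B] [LocallyMConvex B] (φ : A →ₐ[ℂ] B)
    (a : A) : AMEnvelope.lift φ (AMEnvelope.of A a) = φ a :=
  Completion.extensionHom_coe (α := SubmulTop A) φ.toRingHom (SubmulTop.continuous_algHom φ) a

/-- The evaluation of free entire functions at an `n`-tuple of elements of an Arens–Michael
algebra. -/
def FreeEntire.lift {n : ℕ} [IsUniformAddGroup B] [IsTopologicalRing B]
    [CompleteSpace B] [T2Space B] [LocallyMConvex B] (g : Fin n → B) : FreeEntire n →A[ℂ] B :=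
  AMEnvelope.lift (FreeAlgebra.lift ℂ g)

@[simp]
theorem FreeEntire.lift_gen {n : ℕ} [IsUniformAddGroup B] [IsTopologicalRing B]
    [CompleteSpace B] [T2Space B] [LocallyMConvex B] (g : Fin n → B) (i : Fin n) :
    FreeEntire.lift g (FreeEntire.gen i) = g i :=
  (AMEnvelope.lift_of _ _).trans (FreeAlgebra.lift_ι_apply g i)

/-- Polynomials in the generators are dense among the free entire functions. -/
theorem FreeEntire.induction_on {n : ℕ} {P : FreeEntire n → Prop} (x : FreeEntire n)
    (isClosed : IsClosed {x | P x}) (algebraMap : ∀ c, P (algebraMap ℂ _ c))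
    (gen : ∀ i, P (FreeEntire.gen i)) (mul : ∀ x y, P x → P y → P (x * y))
    (add : ∀ x y, P x → P y → P (x + y)) : P x := by
  induction x using Completion.induction_on with
  | hp => exact isClosed
  | ih x =>
    change FreeAlgebra ℂ (Fin n) at x
    change P (AMEnvelope.of _ x)
    induction x using FreeAlgebra.induction with
    | grade0 c => exact algebraMap c
    | grade1 i => exact gen i
    | mul a b ha hb =>
      have := mul _ _ ha hb
      rwa [AMEnvelope.of, AMEnvelope.of, ← Completion.coe_mul] at this
    | add a b ha hb =>
      have := add _ _ ha hb
      rwa [AMEnvelope.of, AMEnvelope.of, ← Completion.coe_add] at this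

end FreeEntire

/-! ### The exponential function -/

section Exp

variable {A : Type*} [Ring A] [Algebra ℂ A] [UniformSpace A] [IsUniformAddGroup A]
  [IsTopologicalRing A] [ContinuousSMul ℂ A] [CompleteSpace A] [T2Space A] [LocallyMConvex A]

omit [IsTopologicalRing A] [ContinuousSMul ℂ A] [T2Space A] in
theorem summable_of_seminorm {ι : Type*} {f : ι → A}
    (h : ∀ p : Seminorm ℂ A, Continuous p → IsSubmul p → Summable fun i => p (f i)) :
    Summable f := by
  rw [summable_iff_vanishing]
  intro U hU
  obtain ⟨p, hp, hs, hpU⟩ := LocallyMConvex.exists_submul U hU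
  obtain ⟨s, hs⟩ := summable_iff_vanishing.1 (h p hp hs) (Set.Iio 1) (Iio_mem_nhds one_pos)
  refine ⟨s, fun t ht => hpU _ (lt_of_le_of_lt ?_ (hs t ht))⟩
  exact Finset.le_sum_of_subadditive p (map_zero p).le (map_add_le_add p) t f

theorem IsSubmul.pow_le {A : Type*} [Ring A] [Algebra ℂ A] {p : Seminorm ℂ A} (hp : IsSubmul p)
    (a : A) (n : ℕ) : p (a ^ n) ≤ p 1 * p a ^ n := by
  induction n with
  | zero => simp
  | succ n ih =>
    rw [pow_succ, pow_succ, ← mul_assoc]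
    exact (hp _ _).trans (mul_le_mul_of_nonneg_right ih (apply_nonneg p a))

theorem IsSubmul.summable_exp {A : Type*} [Ring A] [Algebra ℂ A] {p : Seminorm ℂ A}
    (hp : IsSubmul p) (a : A) : Summable fun n : ℕ => p (((n.factorial : ℂ)⁻¹) • a ^ n) := by
  refine Summable.of_nonneg_of_le (fun n => apply_nonneg p _) (fun n => ?_)
    ((Real.summable_pow_div_factorial (p a)).mul_left (p 1))
  rw [map_smul_eq_mul, norm_inv, Complex.norm_natCast]
  calc ((n.factorial : ℝ))⁻¹ * p (a ^ n) ≤ ((n.factorial : ℝ))⁻¹ * (p 1 * p a ^ n) := by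
        gcongr
        exact hp.pow_le a n
    _ = p 1 * (p a ^ n / n.factorial) := by ring

omit [IsTopologicalRing A] [ContinuousSMul ℂ A] [T2Space A] in
theorem summable_aexp (a : A) : Summable fun n : ℕ => ((n.factorial : ℂ)⁻¹) • a ^ n :=
  summable_of_seminorm fun _ _ hs => hs.summable_exp a

omit [ContinuousSMul ℂ A] in
theorem aexp_add_of_commute {a b : A} (h : Commute a b) : aexp (a + b) = aexp a * aexp b := by
  have hprod : Summable fun x : ℕ × ℕ =>
      (((x.1.factorial : ℂ)⁻¹) • a ^ x.1) * (((x.2.factorial : ℂ)⁻¹) • b ^ x.2) := by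
    refine summable_of_seminorm fun p _ hs => ?_
    refine Summable.of_nonneg_of_le (fun x => apply_nonneg p _) (fun x => hs _ _) ?_
    exact (hs.summable_exp a).mul_of_nonneg (hs.summable_exp b) (fun _ => apply_nonneg p _)
      fun _ => apply_nonneg p _
  rw [aexp, aexp, aexp,
    (summable_aexp a).tsum_mul_tsum_eq_tsum_sum_antidiagonal (summable_aexp b) hprod]
  refine tsum_congr fun n => ?_
  rw [h.add_pow', Finset.smul_sum]
  refine Finset.sum_congr rfl fun x hx => ?_
  rw [← Nat.cast_smul_eq_nsmul ℂ, smul_smul, smul_mul_smul_comm]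
  congr 1
  have hn := Finset.HasAntidiagonal.mem_antidiagonal.1 hx
  rw [← hn, Nat.choose_symm_add, Nat.add_choose,
    Nat.cast_div (Nat.factorial_mul_factorial_dvd_factorial_add _ _)
    (by exact_mod_cast mul_ne_zero (Nat.factorial_ne_zero _) (Nat.factorial_ne_zero _))]
  have h0 : ((x.1 + x.2).factorial : ℂ) ≠ 0 := by exact_mod_cast Nat.factorial_ne_zero _
  push_cast
  field_simp

theorem aexp_zero {A : Type*} [Ring A] [Algebra ℂ A] [TopologicalSpace A] :
    aexp (0 : A) = 1 := by
  rw [aexp, tsum_eq_single 0 fun n hn => by simp [hn]]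
  simp

omit [ContinuousSMul ℂ A] in
@[simp]
theorem aexp_mul_aexp_neg (a : A) : aexp a * aexp (-a) = 1 := by
  rw [← aexp_add_of_commute (Commute.refl a).neg_right, add_neg_cancel, aexp_zero]

omit [ContinuousSMul ℂ A] in
@[simp]
theorem aexp_neg_mul_aexp (a : A) : aexp (-a) * aexp a = 1 := by
  rw [← aexp_add_of_commute (Commute.refl a).neg_left, neg_add_cancel, aexp_zero]

omit [IsUniformAddGroup A] [IsTopologicalRing A] [ContinuousSMul ℂ A] [CompleteSpace A]
  [LocallyMConvex A] in
theorem aexp_op (a : A) : aexp (MulOpposite.op a) = MulOpposite.op (aexp a) := by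
  rw [aexp, aexp, ← tsum_op]
  rfl

omit [IsTopologicalRing A] [ContinuousSMul ℂ A] [T2Space A] in
theorem map_aexp {B : Type*} [Ring B] [Algebra ℂ B] [TopologicalSpace B] [T2Space B]
    (φ : A →A[ℂ] B) (a : A) : φ (aexp a) = aexp (φ a) := by
  rw [aexp, aexp, (summable_aexp a).map_tsum φ φ.cont]
  simp

omit [IsTopologicalRing A] [ContinuousSMul ℂ A] [T2Space A] in
theorem map_asinh {B : Type*} [Ring B] [Algebra ℂ B] [TopologicalSpace B] [T2Space B]
    (φ : A →A[ℂ] B) (a : A) : φ (asinh a) = asinh (φ a) := by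
  simp [asinh, map_aexp]

theorem aexp_complex (c : ℂ) : aexp c = Complex.exp c := by
  rw [Complex.exp_eq_exp_ℂ, NormedSpace.exp_eq_tsum ℂ]
  rfl

omit [IsUniformAddGroup A] [IsTopologicalRing A] [CompleteSpace A] [LocallyMConvex A] in
theorem aexp_smul_one (c : ℂ) : aexp (c • (1 : A)) = Complex.exp c • (1 : A) := by
  let φ : ℂ →A[ℂ] A := ⟨Algebra.ofId ℂ A, continuous_algebraMap ℂ A⟩
  have hφ : ∀ z, φ z = z • (1 : A) := Algebra.algebraMap_eq_smul_one
  rw [← hφ, ← hφ, ← map_aexp, aexp_complex]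

omit [ContinuousSMul ℂ A] in
theorem aexp_mul_eq_mul_aexp {a b x : A} (h : a * x = x * b) : aexp a * x = x * aexp b := by
  rw [aexp, aexp, ← (summable_aexp a).tsum_mul_right, ← (summable_aexp b).tsum_mul_left]
  refine tsum_congr fun n => ?_
  have : SemiconjBy x b a := h.symm
  rw [smul_mul_assoc, mul_smul_comm, (this.pow_right n).eq]

/-- If `[h, x] = c x`, then `e ^ (t h)` and `x` commute up to the scalar `e ^ (t c)`. -/
theorem aexp_smul_mul {h x : A} {c : ℂ} (hx : h * x - x * h = c • x) (t : ℂ) :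
    aexp (t • h) * x = Complex.exp (t * c) • (x * aexp (t • h)) := by
  have h1 : (t • h) * x = x * (t • h + (t * c) • 1) := by
    rw [smul_mul_assoc, sub_eq_iff_eq_add.1 hx, mul_add, mul_smul_comm, mul_smul_comm, mul_one]
    module
  have h2 : Commute (t • h) ((t * c) • (1 : A)) := ((Commute.one_right _).smul_right _)
  rw [aexp_mul_eq_mul_aexp h1, aexp_add_of_commute h2, aexp_smul_one, mul_smul_comm, mul_one,
    mul_smul_comm]

omit [ContinuousSMul ℂ A] in
theorem commute_aexp {a x : A} (h : Commute a x) : Commute (aexp a) x :=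
  aexp_mul_eq_mul_aexp h

end Exp

/-! ### Complete projective tensor products of algebras -/

section Tensor

theorem CTensor.induction_on {E F : Type*} [AddCommGroup E] [Module ℂ E] [AddCommGroup F]
    [Module ℂ F] [TopologicalSpace E] [TopologicalSpace F] {P : CTensor E F → Prop}
    (z : CTensor E F) (isClosed : IsClosed {z | P z}) (mk : ∀ x y, P (CTensor.mk E F x y))
    (add : ∀ z w, P z → P w → P (z + w)) : P z := by
  induction z using Completion.induction_on with
  | hp => exact isClosed
  | ih z =>
    induction z using ProjTensor.induction_on with
    | zero => exact Completion.coe_zero (α := ProjTensor E F) ▸ map_zero (CTensor.mk E F 0) ▸ mk 0 0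
    | tmul x y => exact mk x y
    | add x y hx hy => exact Completion.coe_add (α := ProjTensor E F) x y ▸ add _ _ hx hy

variable {A : Type*} [Ring A] [Algebra ℂ A] [UniformSpace A] [IsUniformAddGroup A]
  [IsTopologicalRing A] [PolynormableSpace ℂ A]
variable {B : Type*} [Ring B] [Algebra ℂ B] [UniformSpace B] [IsUniformAddGroup B]
  [IsTopologicalRing B] [PolynormableSpace ℂ B]

omit [IsUniformAddGroup A] [IsUniformAddGroup B] [IsTopologicalRing A] [PolynormableSpace ℂ A]
  [IsTopologicalRing B] [PolynormableSpace ℂ B] in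
theorem CTensor.one_def : (1 : CTensor A B) = CTensor.mk A B 1 1 := rfl

/-- A continuous linear map on `A ⊗̂ B` that is multiplicative on elementary tensors is a
homomorphism. -/
def CTensor.algHomOfLinear {R : Type*} [Ring R] [Algebra ℂ R] [TopologicalSpace R]
    [IsTopologicalRing R] [T2Space R] (f : CTensor A B →L[ℂ] R) (h1 : f (CTensor.mk A B 1 1) = 1)
    (hmul : ∀ a b a' b', f (CTensor.mk A B (a * a') (b * b')) =
      f (CTensor.mk A B a b) * f (CTensor.mk A B a' b')) : CTensor A B →A[ℂ] R where
  toAlgHom := AlgHom.ofLinearMap f.toLinearMap h1 fun z w => by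
    change f (z * w) = f z * f w
    induction z using CTensor.induction_on with
    | isClosed =>
      exact isClosed_eq (f.continuous.comp (continuous_id.mul continuous_const))
        (f.continuous.mul continuous_const)
    | add z z' hz hz' => rw [add_mul, map_add, map_add, hz, hz', add_mul]
    | mk a b =>
      induction w using CTensor.induction_on with
      | isClosed =>
        exact isClosed_eq (f.continuous.comp (continuous_const.mul continuous_id))
          (continuous_const.mul f.continuous)
      | add z z' hz hz' => rw [mul_add, map_add, map_add, hz, hz', mul_add]
      | mk a' b' => rw [CTensor.mk_mul_mk, hmul]
  cont := f.continuous

/-- The homomorphism `a ↦ a ⊗ 1`. -/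
def CTensor.inl : A →A[ℂ] CTensor A B where
  toAlgHom := AlgHom.ofLinearMap ((CTensor.mk A B).flip 1) rfl fun a b => by
    simp [CTensor.mk_mul_mk]
  cont := CTensor.continuous_mk.comp (continuous_id.prodMk continuous_const)

/-- The homomorphism `b ↦ 1 ⊗ b`. -/
def CTensor.inr : B →A[ℂ] CTensor A B where
  toAlgHom := AlgHom.ofLinearMap (CTensor.mk A B 1) rfl fun a b => by
    simp [CTensor.mk_mul_mk]
  cont :=
    have h (a : A) : Continuous fun b : B => CTensor.mk A B a b :=
      CTensor.continuous_mk.comp (continuous_const.prodMk continuous_id)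
    h 1

omit [IsUniformAddGroup A] [IsUniformAddGroup B] in
theorem CTensor.inl_apply (a : A) : (CTensor.inl a : CTensor A B) = CTensor.mk A B a 1 := rfl

omit [IsUniformAddGroup A] [IsUniformAddGroup B] in
theorem CTensor.inr_apply (b : B) : (CTensor.inr b : CTensor A B) = CTensor.mk A B 1 b := rfl

/-- The tensor product of two continuous homomorphisms. -/
def CTensor.mapA {A' : Type*} [Ring A'] [Algebra ℂ A'] [UniformSpace A'] [IsUniformAddGroup A']
    [IsTopologicalRing A'] [PolynormableSpace ℂ A'] {B' : Type*} [Ring B'] [Algebra ℂ B']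
    [UniformSpace B'] [IsUniformAddGroup B'] [IsTopologicalRing B'] [PolynormableSpace ℂ B']
    (φ : A →A[ℂ] A') (ψ : B →A[ℂ] B') : CTensor A B →A[ℂ] CTensor A' B' :=
  CTensor.algHomOfLinear (CTensor.map φ.toContinuousLinearMap ψ.toContinuousLinearMap)
    (by
      rw [CTensor.map_mk, CTensor.one_def]
      exact congrArg₂ (fun x y => CTensor.mk A' B' x y) (map_one φ) (map_one ψ))
    (fun a b a' b' => by
      rw [CTensor.map_mk, CTensor.map_mk, CTensor.map_mk, CTensor.mk_mul_mk]
      exact congrArg₂ (fun x y => CTensor.mk A' B' x y) (map_mul φ a a') (map_mul ψ b b'))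

/-- In an algebra of tensors, the exponential of `a ⊗ 1 + 1 ⊗ b` is `e ^ a ⊗ e ^ b`. -/
theorem CTensor.aexp_mk_add_mk [ContinuousSMul ℂ A] [CompleteSpace A] [T2Space A]
    [LocallyMConvex A] [ContinuousSMul ℂ B] [CompleteSpace B] [T2Space B] [LocallyMConvex B]
    (a : A) (b : B) : aexp (CTensor.mk A B a 1 + CTensor.mk A B 1 b) =
      CTensor.mk A B (aexp a) (aexp b) := by
  have hc : Commute (CTensor.mk A B a 1) (CTensor.mk A B 1 b) := by
    simp [Commute, SemiconjBy, CTensor.mk_mul_mk]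
  rw [aexp_add_of_commute hc, ← CTensor.inl_apply, ← CTensor.inr_apply, ← map_aexp, ← map_aexp,
    CTensor.inl_apply, CTensor.inr_apply, CTensor.mk_mul_mk, mul_one, one_mul]

end Tensor

/-! ### Algebra structures on iterated tensor products -/

section Triple

variable {A : Type*} [Ring A] [Algebra ℂ A] [UniformSpace A] [IsUniformAddGroup A]
  [IsTopologicalRing A] [PolynormableSpace ℂ A]
variable {B : Type*} [Ring B] [Algebra ℂ B] [UniformSpace B] [IsUniformAddGroup B]
  [IsTopologicalRing B] [PolynormableSpace ℂ B]
variable {C : Type*} [Ring C] [Algebra ℂ C] [UniformSpace C] [IsUniformAddGroup C]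
  [IsTopologicalRing C] [PolynormableSpace ℂ C]

-- The algebra structure of `A ⊗ B` is not found by unification when a factor is itself a completed
-- tensor product, whose module structure has two (definitionally equal) forms.
instance ProjTensor.ringRight : Ring (ProjTensor A (CTensor B C)) :=
  @instRingProjTensor A _ _ (CTensor B C) _ _

instance ProjTensor.algebraRight : Algebra ℂ (ProjTensor A (CTensor B C)) :=
  @instAlgebraComplexProjTensor A _ _ (CTensor B C) _ _

instance ProjTensor.isTopologicalRingRight : IsTopologicalRing (ProjTensor A (CTensor B C)) :=
  @instIsTopologicalRingProjTensor A _ _ (CTensor B C) _ _ _ _ _ _ _ _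

instance ProjTensor.ringLeft : Ring (ProjTensor (CTensor A B) C) :=
  @instRingProjTensor (CTensor A B) _ _ C _ _

instance ProjTensor.algebraLeft : Algebra ℂ (ProjTensor (CTensor A B) C) :=
  @instAlgebraComplexProjTensor (CTensor A B) _ _ C _ _

instance ProjTensor.isTopologicalRingLeft : IsTopologicalRing (ProjTensor (CTensor A B) C) :=
  @instIsTopologicalRingProjTensor (CTensor A B) _ _ C _ _ _ _ _ _ _ _

omit [IsUniformAddGroup A] [IsUniformAddGroup B] [IsUniformAddGroup C] in
theorem CTensor.mk_mul_mk_right (a a' : A) (z z' : CTensor B C) :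
    CTensor.mk A (CTensor B C) a z * CTensor.mk A (CTensor B C) a' z' =
      CTensor.mk A (CTensor B C) (a * a') (z * z') :=
  CTensor.mk_mul_mk A (CTensor B C) a a' z z'

/-- The associativity constraint is multiplicative. -/
def CTensor.assocA : CTensor (CTensor A B) C →A[ℂ] CTensor A (CTensor B C) :=
  CTensor.algHomOfLinear (A := CTensor A B) (B := C) (CTensor.assoc A B C)
    (CTensor.assoc_mk A B C 1 1 1)
    (fun z c z' c' => by
      have hc (c : C) : Continuous fun z : CTensor A B =>
          CTensor.assoc A B C (CTensor.mk (CTensor A B) C z c) :=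
        (CTensor.assoc A B C).continuous.comp (CTensor.mkRight (CTensor A B) c).continuous
      induction z using CTensor.induction_on with
      | isClosed =>
        exact isClosed_eq ((hc _).comp (continuous_id.mul continuous_const))
          ((hc _).mul continuous_const)
      | add z w hz hw => simp only [add_mul, map_add, LinearMap.add_apply, hz, hw]
      | mk a b =>
        induction z' using CTensor.induction_on with
        | isClosed =>
          exact isClosed_eq ((hc _).comp (continuous_const.mul continuous_id))
            (continuous_const.mul (hc _))
        | add z w hz hw => simp only [mul_add, map_add, LinearMap.add_apply, hz, hw]
        | mk a' b' =>
          rw [CTensor.mk_mul_mk, CTensor.assoc_mk, CTensor.assoc_mk, CTensor.assoc_mk,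
            CTensor.mk_mul_mk_right, CTensor.mk_mul_mk])

end Triple

/-! ### Consequences of the relations -/

section Relations

variable {A : Type*} [Ring A] [Algebra ℂ A] [UniformSpace A] [IsUniformAddGroup A]
  [IsTopologicalRing A] [ContinuousSMul ℂ A] [CompleteSpace A] [T2Space A] [LocallyMConvex A]
variable {ħ : ℂ} {e f h : A}

omit [IsUniformAddGroup A] [ContinuousSMul ℂ A] [T2Space A] [CompleteSpace A] [LocallyMConvex A]
  [IsTopologicalRing A] in
theorem asinh_smul (h : A) :
    asinh (ħ • h) = (2 : ℂ)⁻¹ • (aexp (ħ • h) - aexp (-(ħ • h))) := rfl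

theorem Sl2Relations.aexp_mul_e (hr : Sl2Relations ħ e f h) :
    aexp (ħ • h) * e = Complex.exp (2 * ħ) • (e * aexp (ħ • h)) := by
  rw [aexp_smul_mul hr.he, mul_comm ħ]

theorem Sl2Relations.aexp_neg_mul_e (hr : Sl2Relations ħ e f h) :
    aexp (-(ħ • h)) * e = Complex.exp (-(2 * ħ)) • (e * aexp (-(ħ • h))) := by
  rw [← neg_smul, aexp_smul_mul hr.he]
  ring_nf

theorem Sl2Relations.aexp_mul_f (hr : Sl2Relations ħ e f h) :
    aexp (ħ • h) * f = Complex.exp (-(2 * ħ)) • (f * aexp (ħ • h)) := by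
  rw [aexp_smul_mul (c := -2) (by rw [hr.hf, neg_smul])]
  ring_nf

omit [ContinuousSMul ℂ A] in
theorem commute_aexp_smul (t : ℂ) (h : A) : Commute h (aexp (t • h)) :=
  (commute_aexp ((Commute.refl h).smul_left t)).symm

omit [ContinuousSMul ℂ A] in
theorem commute_aexp_neg_smul (t : ℂ) (h : A) : Commute h (aexp (-(t • h))) := by
  rw [← neg_smul]
  exact commute_aexp_smul _ h

/-- The scaling `e ↦ c e`, `f ↦ c⁻¹ f`, `h ↦ h` preserves the relations. -/
theorem Sl2Relations.scale {A : Type*} [Ring A] [Algebra ℂ A] [TopologicalSpace A] {e f h : A}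
    (hr : Sl2Relations ħ e f h) {c d : ℂ} (hcd : c * d = 1) :
    Sl2Relations ħ (c • e) (d • f) h where
  he := by rw [mul_smul_comm, smul_mul_assoc, ← smul_sub, hr.he, smul_comm]
  hf := by rw [mul_smul_comm, smul_mul_assoc, ← smul_sub, hr.hf, smul_neg, smul_comm]
  ef := by
    rw [smul_mul_smul_comm, smul_mul_smul_comm, mul_comm d c, hcd, one_smul, one_smul, hr.ef]

/-- The images of the generators under the antipode satisfy the relations in the opposite
algebra. -/
theorem Sl2Relations.antipode (hr : Sl2Relations ħ e f h) :
    Sl2Relations ħ (MulOpposite.op (-(e * aexp (-(ħ • h)))))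
      (MulOpposite.op (-(aexp (ħ • h) * f))) (MulOpposite.op (-h)) where
  he := by
    rw [← MulOpposite.op_mul, ← MulOpposite.op_mul, ← MulOpposite.op_sub, ← MulOpposite.op_smul]
    congr 1
    rw [neg_mul_neg, neg_mul_neg, mul_assoc, ← (commute_aexp_neg_smul ħ h).eq, ← mul_assoc,
      ← mul_assoc, ← sub_mul, ← neg_sub, hr.he, neg_mul, smul_neg, smul_mul_assoc]
  hf := by
    rw [← MulOpposite.op_mul, ← MulOpposite.op_mul, ← MulOpposite.op_sub, ← MulOpposite.op_smul,
      ← MulOpposite.op_neg]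
    congr 1
    rw [neg_mul_neg, neg_mul_neg, ← mul_assoc, (commute_aexp_smul ħ h).eq, mul_assoc, mul_assoc,
      ← mul_sub, ← neg_sub, hr.hf, neg_neg, mul_smul_comm, smul_neg, neg_neg]
  ef := by
    have h1 : aexp (ħ • h) * f * (e * aexp (-(ħ • h))) = f * e := by
      rw [hr.aexp_mul_f, smul_mul_assoc, mul_assoc f, ← mul_assoc (aexp _) e, hr.aexp_mul_e,
        smul_mul_assoc, mul_smul_comm, smul_smul, ← Complex.exp_add, neg_add_cancel,
        Complex.exp_zero, one_smul, mul_assoc e, aexp_mul_aexp_neg, mul_one]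
    have h2 : e * aexp (-(ħ • h)) * (aexp (ħ • h) * f) = e * f := by
      rw [mul_assoc, ← mul_assoc (aexp _) (aexp _), aexp_neg_mul_aexp, one_mul]
    rw [← MulOpposite.op_mul, ← MulOpposite.op_mul, ← MulOpposite.op_sub, neg_mul_neg, neg_mul_neg,
      h1, h2, asinh_smul, ← MulOpposite.op_smul, ← MulOpposite.op_neg, aexp_op, aexp_op,
      ← MulOpposite.op_sub, ← MulOpposite.op_smul, ← MulOpposite.op_smul, smul_neg, neg_neg,
      ← neg_sub, hr.ef, asinh_smul, ← smul_neg, ← smul_neg, neg_sub]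

variable [PolynormableSpace ℂ A]

/-- The images of the generators under the comultiplication satisfy the relations. -/
theorem Sl2Relations.comul (hr : Sl2Relations ħ e f h) :
    Sl2Relations ħ (CTensor.mk A A e (aexp (ħ • h)) + CTensor.mk A A 1 e)
      (CTensor.mk A A f 1 + CTensor.mk A A (aexp (-(ħ • h))) f)
      (CTensor.mk A A h 1 + CTensor.mk A A 1 h) where
  he := by
    simp only [mul_add, add_mul, CTensor.mk_mul_mk, one_mul, mul_one, sub_eq_iff_eq_add.1 hr.he,
      (commute_aexp_smul ħ h).eq, map_add, map_smul, LinearMap.add_apply, LinearMap.smul_apply,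
      smul_add]
    abel
  hf := by
    simp only [mul_add, add_mul, CTensor.mk_mul_mk, one_mul, mul_one, sub_eq_iff_eq_add.1 hr.hf,
      (commute_aexp_neg_smul ħ h).eq, map_add, map_smul, map_neg, LinearMap.add_apply,
      LinearMap.smul_apply, LinearMap.neg_apply, smul_add]
    abel
  ef := by
    have hk : aexp (ħ • (CTensor.mk A A h 1 + CTensor.mk A A 1 h)) =
        CTensor.mk A A (aexp (ħ • h)) (aexp (ħ • h)) := by
      rw [← CTensor.aexp_mk_add_mk, smul_add, map_smul, map_smul, LinearMap.smul_apply]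
    have hk' : aexp (-(ħ • (CTensor.mk A A h 1 + CTensor.mk A A 1 h))) =
        CTensor.mk A A (aexp (-(ħ • h))) (aexp (-(ħ • h))) := by
      rw [← CTensor.aexp_mk_add_mk, smul_add, map_neg, map_neg, map_smul, map_smul,
        LinearMap.neg_apply, LinearMap.smul_apply, neg_add]
    -- The cross terms `[e ⊗ k, k⁻¹ ⊗ f]` vanish: the scalars produced by moving `k⁻¹` past `e`
    -- and `k` past `f` are inverse to each other.
    have hx : CTensor.mk A A (e * aexp (-(ħ • h))) (aexp (ħ • h) * f) =
        CTensor.mk A A (aexp (-(ħ • h)) * e) (f * aexp (ħ • h)) := by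
      rw [hr.aexp_mul_f, hr.aexp_neg_mul_e, map_smul, map_smul, LinearMap.smul_apply]
    rw [asinh_smul, hk, hk']
    simp only [mul_add, add_mul, CTensor.mk_mul_mk, one_mul, mul_one, hx,
      sub_eq_iff_eq_add.1 hr.ef, asinh_smul, map_add, map_smul, map_sub, LinearMap.add_apply,
      LinearMap.smul_apply, LinearMap.sub_apply, smul_sub]
    abel

end Relations

/-! ### The Hopf algebra axioms -/

section Hopf

theorem induction_of_dense {A : Type*} [Ring A] [Algebra ℂ A] [TopologicalSpace A] {s : Set A}
    (hs : Dense (Algebra.adjoin ℂ s : Set A)) {P : A → Prop} (x : A)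
    (isClosed : IsClosed {x | P x}) (mem : ∀ x ∈ s, P x)
    (algebraMap : ∀ c, P (algebraMap ℂ A c)) (add : ∀ x y, P x → P y → P (x + y))
    (mul : ∀ x y, P x → P y → P (x * y)) : P x := by
  have hle : closure (Algebra.adjoin ℂ s : Set A) ⊆ {x | P x} :=
    isClosed.closure_subset_iff.2 fun x hx =>
      Algebra.adjoin_induction (p := fun x _ => P x) (fun x hx => mem x hx) algebraMap
        (fun x y _ _ => add x y) (fun x y _ _ => mul x y) hx
  exact hle (hs x)

variable {A : Type*} [Ring A] [Algebra ℂ A] [UniformSpace A] [IsUniformAddGroup A]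
  [IsTopologicalRing A] [ContinuousSMul ℂ A] [PolynormableSpace ℂ A] [CompleteSpace A] [T2Space A]

/-- The left unit constraint is multiplicative. -/
def CTensor.lidA : CTensor ℂ A →A[ℂ] A :=
  CTensor.algHomOfLinear (CTensor.lid A) (by simp) fun a b a' b' => by
    simp only [CTensor.lid_mk, smul_mul_smul_comm]

/-- The right unit constraint is multiplicative. -/
def CTensor.ridA : CTensor A ℂ →A[ℂ] A :=
  CTensor.algHomOfLinear (CTensor.rid A) (by simp) fun a b a' b' => by
    simp only [CTensor.rid_mk, smul_mul_smul_comm]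

omit [ContinuousSMul ℂ A] in
/-- Let `S` be an antihomomorphism and `S * id` the map `a ⊗ b ↦ S a * b`. If `S * id` has a scalar
value at `z`, then it is multiplicative at `z` on the left. -/
theorem CTensor.mul'_map_mul_left {S : A →L[ℂ] A} (hS : ∀ a b, S (a * b) = S b * S a)
    {z : CTensor A A} {c : ℂ}
    (hz : CTensor.mul' A (CTensor.map S (ContinuousLinearMap.id ℂ A) z) = algebraMap ℂ A c)
    (w : CTensor A A) :
    CTensor.mul' A (CTensor.map S (ContinuousLinearMap.id ℂ A) (z * w)) =
      algebraMap ℂ A c * CTensor.mul' A (CTensor.map S (ContinuousLinearMap.id ℂ A) w) := by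
  set L : CTensor A A →L[ℂ] A :=
    (CTensor.mul' A).comp (CTensor.map S (ContinuousLinearMap.id ℂ A)) with hL
  have hmk (a b : A) : L (CTensor.mk A A a b) = S a * b := by simp [hL]
  change L z = _ at hz
  change L (z * w) = _ * L w
  have key (a b : A) : L (z * CTensor.mk A A a b) = S a * L z * b := by
    clear hz
    induction z using CTensor.induction_on with
    | isClosed =>
      exact isClosed_eq (L.continuous.comp (continuous_id.mul continuous_const))
        ((continuous_const.mul L.continuous).mul continuous_const)
    | mk x y => rw [CTensor.mk_mul_mk, hmk, hmk, hS]; simp only [mul_assoc]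
    | add z z' h h' => rw [add_mul, map_add, map_add, h, h', mul_add, add_mul]
  induction w using CTensor.induction_on with
  | isClosed =>
    exact isClosed_eq (L.continuous.comp (continuous_const.mul continuous_id))
      (continuous_const.mul L.continuous)
  | mk x y => rw [key, hz, hmk, ← Algebra.commutes, mul_assoc]
  | add w w' h h' => rw [mul_add, map_add, map_add, h, h', mul_add]

omit [ContinuousSMul ℂ A] in
/-- Let `S` be an antihomomorphism and `id * S` the map `a ⊗ b ↦ a * S b`. If `id * S` has a scalar
value at `w`, then it is multiplicative at `w` on the right. -/
theorem CTensor.mul'_map_mul_right {S : A →L[ℂ] A} (hS : ∀ a b, S (a * b) = S b * S a)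
    {w : CTensor A A} {c : ℂ}
    (hw : CTensor.mul' A (CTensor.map (ContinuousLinearMap.id ℂ A) S w) = algebraMap ℂ A c)
    (z : CTensor A A) :
    CTensor.mul' A (CTensor.map (ContinuousLinearMap.id ℂ A) S (z * w)) =
      CTensor.mul' A (CTensor.map (ContinuousLinearMap.id ℂ A) S z) * algebraMap ℂ A c := by
  set L : CTensor A A →L[ℂ] A :=
    (CTensor.mul' A).comp (CTensor.map (ContinuousLinearMap.id ℂ A) S) with hL
  have hmk (a b : A) : L (CTensor.mk A A a b) = a * S b := by simp [hL]
  change L w = _ at hw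
  change L (z * w) = L z * _
  have key (a b : A) : L (CTensor.mk A A a b * w) = a * L w * S b := by
    clear hw
    induction w using CTensor.induction_on with
    | isClosed =>
      exact isClosed_eq (L.continuous.comp (continuous_const.mul continuous_id))
        ((continuous_const.mul L.continuous).mul continuous_const)
    | mk x y => rw [CTensor.mk_mul_mk, hmk, hmk, hS]; simp only [mul_assoc]
    | add z z' h h' => rw [mul_add, map_add, map_add, h, h', mul_add, add_mul]
  induction z using CTensor.induction_on with
  | isClosed =>
    exact isClosed_eq (L.continuous.comp (continuous_id.mul continuous_const))
      (L.continuous.mul continuous_const)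
  | mk x y => rw [key, hw, hmk, mul_assoc, mul_assoc, Algebra.commutes]
  | add w w' h h' => rw [add_mul, map_add, map_add, h, h', add_mul]

/-- If `e`, `f`, `h` generate a dense subalgebra, it suffices to verify the axioms of a Hopf algebra
on `e`, `f`, `h`, where they follow from the formulas for `Δ`, `ε` and `S`. -/
theorem Sl2Relations.isHopfCTensor [LocallyMConvex A] {ħ : ℂ} {e f h : A}
    (hd : Dense (Algebra.adjoin ℂ {e, f, h} : Set A)) {Δ : A →A[ℂ] CTensor A A} {ε : A →A[ℂ] ℂ}
    {S : A →L[ℂ] A}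
    (hΔh : Δ h = CTensor.mk A A h 1 + CTensor.mk A A 1 h)
    (hΔe : Δ e = CTensor.mk A A e (aexp (ħ • h)) + CTensor.mk A A 1 e)
    (hΔf : Δ f = CTensor.mk A A f 1 + CTensor.mk A A (aexp (-(ħ • h))) f)
    (hεh : ε h = 0) (hεe : ε e = 0) (hεf : ε f = 0)
    (hS1 : S 1 = 1) (hS : ∀ a b, S (a * b) = S b * S a) (hSh : S h = -h)
    (hSe : S e = -(e * aexp (-(ħ • h)))) (hSf : S f = -(aexp (ħ • h) * f)) :
    IsHopfCTensor A Δ ε S := by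
  have hΔ1 : Δ 1 = CTensor.mk A A 1 1 := map_one Δ
  have hΔk (t : ℂ) : Δ (aexp (t • h)) = CTensor.mk A A (aexp (t • h)) (aexp (t • h)) := by
    rw [map_aexp, map_smul, hΔh, ← CTensor.aexp_mk_add_mk, smul_add, map_smul, map_smul,
      LinearMap.smul_apply]
  have hεk (t : ℂ) : ε (aexp (t • h)) = 1 := by
    rw [map_aexp, map_smul, hεh, smul_zero, aexp_zero]
  have hSk (t : ℂ) : S (aexp (t • h)) = aexp (-(t • h)) := by
    let Sop : A →A[ℂ] Aᵐᵒᵖ :=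
      { toAlgHom := AlgHom.ofLinearMap
          ((MulOpposite.opLinearEquiv ℂ).toLinearMap.comp S.toLinearMap)
          (congrArg MulOpposite.op hS1) fun a b => congrArg MulOpposite.op (hS a b)
        cont := MulOpposite.continuous_op.comp S.continuous }
    have h1 : Sop (aexp (t • h)) = MulOpposite.op (aexp (-(t • h))) := by
      rw [map_aexp, map_smul, ← smul_neg, ← aexp_op, ← hSh]
      rfl
    exact congrArg MulOpposite.unop h1
  have hΔk' : Δ (aexp (-(ħ • h))) = CTensor.mk A A (aexp (-(ħ • h))) (aexp (-(ħ • h))) := by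
    simpa only [neg_smul] using hΔk (-ħ)
  have hεk' : ε (aexp (-(ħ • h))) = 1 := by simpa only [neg_smul] using hεk (-ħ)
  have hSk' : S (aexp (-(ħ • h))) = aexp (ħ • h) := by
    simpa only [neg_smul, neg_neg] using hSk (-ħ)
  refine ⟨fun a => ?_, fun a => ?_, fun a => ?_, fun a => ?_, fun a => ?_⟩
  · have hom : (CTensor.assocA.comp ((CTensor.mapA Δ (ContinuousAlgHom.id ℂ A)).comp Δ)) =
        (CTensor.mapA (ContinuousAlgHom.id ℂ A) Δ).comp Δ := by
      refine ContinuousAlgHom.ext_on hd ?_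
      intro x hx
      change CTensor.assoc A A A (CTensor.map Δ.toContinuousLinearMap
        (ContinuousLinearMap.id ℂ A) (Δ x)) =
          CTensor.map (ContinuousLinearMap.id ℂ A) Δ.toContinuousLinearMap (Δ x)
      rcases hx with rfl | rfl | rfl
      · simp [hΔe, hΔk, hΔ1, add_assoc]
      · simp [hΔf, hΔk', hΔ1, add_assoc]
      · simp [hΔh, hΔ1, add_assoc]
    exact DFunLike.congr_fun hom a
  · have hom : CTensor.lidA.comp ((CTensor.mapA ε (ContinuousAlgHom.id ℂ A)).comp Δ) =
        ContinuousAlgHom.id ℂ A := by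
      refine ContinuousAlgHom.ext_on hd ?_
      intro x hx
      change CTensor.lid A (CTensor.map ε.toContinuousLinearMap
        (ContinuousLinearMap.id ℂ A) (Δ x)) = x
      rcases hx with rfl | rfl | rfl
      · simp [hΔe, hεe]
      · simp [hΔf, hεf, hεk']
      · simp [hΔh, hεh]
    exact DFunLike.congr_fun hom a
  · have hom : CTensor.ridA.comp ((CTensor.mapA (ContinuousAlgHom.id ℂ A) ε).comp Δ) =
        ContinuousAlgHom.id ℂ A := by
      refine ContinuousAlgHom.ext_on hd ?_
      intro x hx
      change CTensor.rid A (CTensor.map (ContinuousLinearMap.id ℂ A)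
        ε.toContinuousLinearMap (Δ x)) = x
      rcases hx with rfl | rfl | rfl
      · simp [hΔe, hεe, hεk]
      · simp [hΔf, hεf]
      · simp [hΔh, hεh]
    exact DFunLike.congr_fun hom a
  · induction a using induction_of_dense hd with
    | isClosed =>
      exact isClosed_eq (((CTensor.mul' A).comp (CTensor.map S _)).continuous.comp Δ.cont)
        ((continuous_algebraMap ℂ A).comp ε.cont)
    | mem x hx =>
      rcases hx with rfl | rfl | rfl
      · simp [hΔe, hSe, hεe, hS1, mul_assoc]
      · simp [hΔf, hSf, hεf, hSk']
      · simp [hΔh, hSh, hεh, hS1]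
    | algebraMap c =>
      simp [Algebra.algebraMap_eq_smul_one, hΔ1, hS1]
    | add x y hx hy => rw [map_add, map_add, map_add, map_add, map_add, hx, hy]
    | mul x y hx hy => rw [map_mul Δ, CTensor.mul'_map_mul_left hS hx, hy, map_mul, map_mul]
  · induction a using induction_of_dense hd with
    | isClosed =>
      exact isClosed_eq (((CTensor.mul' A).comp (CTensor.map _ S)).continuous.comp Δ.cont)
        ((continuous_algebraMap ℂ A).comp ε.cont)
    | mem x hx =>
      rcases hx with rfl | rfl | rfl
      · simp [hΔe, hSe, hεe, hSk]
      · simp [hΔf, hSf, hεf, hS1, ← mul_assoc]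
      · simp [hΔh, hSh, hεh, hS1]
    | algebraMap c =>
      simp [Algebra.algebraMap_eq_smul_one, hΔ1, hS1]
    | add x y hx hy => rw [map_add, map_add, map_add, map_add, map_add, hx, hy]
    | mul x y hx hy => rw [map_mul Δ, CTensor.mul'_map_mul_right hS hy, hx, map_mul, map_mul]

end Hopf

/-! ### The algebra `Ũ(sl₂)_ħ` -/

section USl2

variable (ħ : ℂ)

theorem USl2.relations : Sl2Relations ħ (USl2.E ħ) (USl2.F ħ) (USl2.H ħ) where
  he := by
    have h := ClosedQuot.mk_eq_zero (s := sl2Relators ħ) (Or.inl rfl)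
    rwa [map_sub, map_sub, map_mul, map_mul, ClosedQuot.mk_smul, sub_eq_zero] at h
  hf := by
    have h := ClosedQuot.mk_eq_zero (s := sl2Relators ħ) (Or.inr (Or.inl rfl))
    rwa [map_add, map_sub, map_mul, map_mul, ClosedQuot.mk_smul, add_eq_zero_iff_eq_neg] at h
  ef := by
    have h := ClosedQuot.mk_eq_zero (s := sl2Relators ħ) (Or.inr (Or.inr rfl))
    have hs : ClosedQuot.mk (sl2Relators ħ) (asinh (ħ • FreeEntire.gen 2)) =
        asinh (ħ • USl2.H ħ) :=
      (map_asinh (ClosedQuot.mkA (sl2Relators ħ)) _).trans (by rw [map_smul]; rfl)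
    rwa [map_sub, map_sub, map_mul, map_mul, ClosedQuot.mk_smul, sub_eq_zero, hs] at h

theorem USl2.isHFG : IsHFG (USl2 ħ) where
  toIsArensMichael := LocallyMConvex.isArensMichael
  metrizableSpace := by
    have : (uniformity (USl2 ħ)).IsCountablyGenerated :=
      IsUniformAddGroup.uniformity_countably_generated
    exact UniformSpace.metrizableSpace
  exists_generators := ⟨3, ClosedQuot.mkA _, ClosedQuot.mk_surjective _⟩

theorem USl2.dense_adjoin :
    Dense (Algebra.adjoin ℂ {USl2.E ħ, USl2.F ħ, USl2.H ħ} : Set (USl2 ħ)) := by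
  intro x
  have hle : ∀ y, y ∈ ({USl2.E ħ, USl2.F ħ, USl2.H ħ} : Set (USl2 ħ)) →
      y ∈ (Algebra.adjoin ℂ {USl2.E ħ, USl2.F ħ, USl2.H ħ}).topologicalClosure := fun y hy =>
    Subalgebra.le_topologicalClosure _ (Algebra.subset_adjoin hy)
  change x ∈ (Algebra.adjoin ℂ {USl2.E ħ, USl2.F ħ, USl2.H ħ}).topologicalClosure
  obtain ⟨x, rfl⟩ := ClosedQuot.mk_surjective _ x
  induction x using FreeEntire.induction_on with
  | isClosed =>
    exact (Subalgebra.isClosed_topologicalClosure _).preimage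
      (ClosedQuot.isOpenQuotientMap_mk _).continuous
  | algebraMap c => exact Subalgebra.algebraMap_mem _ c
  | gen i =>
    refine hle _ ?_
    fin_cases i
    · exact Or.inl rfl
    · exact Or.inr (Or.inl rfl)
    · exact Or.inr (Or.inr rfl)
  | mul x y hx hy =>
    rw [map_mul]
    exact mul_mem hx hy
  | add x y hx hy =>
    rw [map_add]
    exact add_mem hx hy

variable {ħ} {B : Type*} [Ring B] [Algebra ℂ B] [UniformSpace B]

theorem USl2.hom_ext [T2Space B] {φ ψ : USl2 ħ →A[ℂ] B} (hE : φ (USl2.E ħ) = ψ (USl2.E ħ))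
    (hF : φ (USl2.F ħ) = ψ (USl2.F ħ)) (hH : φ (USl2.H ħ) = ψ (USl2.H ħ)) : φ = ψ := by
  refine ContinuousAlgHom.ext_on (USl2.dense_adjoin ħ) ?_
  rintro x (rfl | rfl | rfl)
  exacts [hE, hF, hH]

variable [IsUniformAddGroup B] [IsTopologicalRing B] [CompleteSpace B] [T2Space B]
  [LocallyMConvex B] {e f h : B}

/-- The homomorphism to an Arens–Michael algebra determined by elements that satisfy the
relations. -/
def USl2.lift (hr : Sl2Relations ħ e f h) : USl2 ħ →A[ℂ] B :=
  ClosedQuot.lift (sl2Relators ħ) (FreeEntire.lift ![e, f, h]) fun a ha => by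
    rcases ha with rfl | rfl | rfl
    · simp [hr.he]
    · simp [hr.hf]
    · simp [hr.ef, map_asinh]

@[simp]
theorem USl2.lift_E (hr : Sl2Relations ħ e f h) : USl2.lift hr (USl2.E ħ) = e :=
  FreeEntire.lift_gen _ _

@[simp]
theorem USl2.lift_F (hr : Sl2Relations ħ e f h) : USl2.lift hr (USl2.F ħ) = f :=
  FreeEntire.lift_gen _ _

@[simp]
theorem USl2.lift_H (hr : Sl2Relations ħ e f h) : USl2.lift hr (USl2.H ħ) = h :=
  FreeEntire.lift_gen _ _

/-- `Ũ(sl₂)_ħ` has infinitely many characters that kill `E` and `F`: they take `H` to the zeros of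
`z ↦ sinh (ħ z)`. Hence `H` is not algebraic. -/
theorem USl2.not_finiteDimensional (hħ : Complex.sinh ħ ≠ 0) :
    ¬ FiniteDimensional ℂ (USl2 ħ) := by
  intro hfin
  have hħ0 : ħ ≠ 0 := by
    rintro rfl
    exact hħ Complex.sinh_zero
  have hr (m : ℕ) : Sl2Relations ħ (0 : ℂ) 0 (m * (Real.pi * Complex.I) / ħ) := by
    refine ⟨by simp, by simp, ?_⟩
    have h1 : ħ • ((m : ℂ) * (Real.pi * Complex.I) / ħ) = m * (Real.pi * Complex.I) := by
      rw [smul_eq_mul]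
      field_simp
    have h2 : Complex.exp (-(m * (Real.pi * Complex.I))) =
        Complex.exp (m * (Real.pi * Complex.I)) := by
      rw [Complex.exp_eq_exp_iff_exists_int]
      exact ⟨-m, by push_cast; ring⟩
    rw [h1, asinh, aexp_complex, aexp_complex, h2]
    simp
  obtain ⟨p, hp, hpH⟩ := Algebra.IsIntegral.isIntegral (R := ℂ) (USl2.H ħ)
  have hroot (m : ℕ) : p.IsRoot (m * (Real.pi * Complex.I) / ħ) := by
    have h1 := congrArg (USl2.lift (hr m)).toAlgHom hpH
    rw [map_zero, ← Polynomial.aeval_def, ← Polynomial.aeval_algHom_apply] at h1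
    have h2 : (USl2.lift (hr m)).toAlgHom (USl2.H ħ) = m * (Real.pi * Complex.I) / ħ :=
      USl2.lift_H (hr m)
    rw [h2] at h1
    simpa using h1
  refine hp.ne_zero (Polynomial.eq_zero_of_infinite_isRoot p
    ((Set.infinite_range_of_injective (f := fun m : ℕ =>
      (m : ℂ) * (Real.pi * Complex.I) / ħ) fun m n hmn => ?_).mono ?_))
  · have hπ : (Real.pi : ℂ) * Complex.I ≠ 0 :=
      mul_ne_zero (by exact_mod_cast Real.pi_ne_zero) Complex.I_ne_zero
    have := mul_right_cancel₀ hπ ((div_left_inj' hħ0).1 hmn)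
    exact_mod_cast this
  · rintro _ ⟨m, rfl⟩
    exact hroot m

variable (ħ)

/-- The comultiplication of `Ũ(sl₂)_ħ`. -/
def USl2.comul : USl2 ħ →A[ℂ] CTensor (USl2 ħ) (USl2 ħ) :=
  USl2.lift (USl2.relations ħ).comul

/-- The counit of `Ũ(sl₂)_ħ`. -/
def USl2.counit : USl2 ħ →A[ℂ] ℂ :=
  USl2.lift (e := 0) (f := 0) (h := 0) ⟨by simp, by simp, by simp [asinh]⟩

/-- The antipode of `Ũ(sl₂)_ħ`, as a homomorphism to the opposite algebra. -/
def USl2.antipodeOp : USl2 ħ →A[ℂ] (USl2 ħ)ᵐᵒᵖ :=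
  USl2.lift (USl2.relations ħ).antipode

/-- The antipode of `Ũ(sl₂)_ħ`. -/
def USl2.antipode : USl2 ħ →L[ℂ] USl2 ħ :=
  (MulOpposite.opContinuousLinearEquiv ℂ).symm.toContinuousLinearMap.comp
    (USl2.antipodeOp ħ).toContinuousLinearMap

theorem USl2.antipode_one : USl2.antipode ħ 1 = 1 :=
  congrArg MulOpposite.unop (map_one (USl2.antipodeOp ħ))

theorem USl2.antipode_mul (a b : USl2 ħ) :
    USl2.antipode ħ (a * b) = USl2.antipode ħ b * USl2.antipode ħ a :=
  congrArg MulOpposite.unop (map_mul (USl2.antipodeOp ħ) a b)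

theorem USl2.antipode_H : USl2.antipode ħ (USl2.H ħ) = -USl2.H ħ :=
  congrArg MulOpposite.unop (USl2.lift_H (USl2.relations ħ).antipode)

theorem USl2.antipode_E :
    USl2.antipode ħ (USl2.E ħ) = -(USl2.E ħ * aexp (-(ħ • USl2.H ħ))) :=
  congrArg MulOpposite.unop (USl2.lift_E (USl2.relations ħ).antipode)

theorem USl2.antipode_F : USl2.antipode ħ (USl2.F ħ) = -(aexp (ħ • USl2.H ħ) * USl2.F ħ) :=
  congrArg MulOpposite.unop (USl2.lift_F (USl2.relations ħ).antipode)

theorem USl2.antipode_unique {S : USl2 ħ →L[ℂ] USl2 ħ} (h1 : S 1 = 1)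
    (hmul : ∀ a b, S (a * b) = S b * S a) (hH : S (USl2.H ħ) = -USl2.H ħ)
    (hE : S (USl2.E ħ) = -(USl2.E ħ * aexp (-(ħ • USl2.H ħ))))
    (hF : S (USl2.F ħ) = -(aexp (ħ • USl2.H ħ) * USl2.F ħ)) : S = USl2.antipode ħ := by
  ext x
  induction x using induction_of_dense (USl2.dense_adjoin ħ) with
  | isClosed => exact isClosed_eq S.continuous (USl2.antipode ħ).continuous
  | mem x hx =>
    rcases hx with rfl | rfl | rfl
    · rw [hE, USl2.antipode_E]
    · rw [hF, USl2.antipode_F]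
    · rw [hH, USl2.antipode_H]
  | algebraMap c =>
    rw [Algebra.algebraMap_eq_smul_one, map_smul, map_smul, h1, USl2.antipode_one]
  | add x y hx hy => rw [map_add, map_add, hx, hy]
  | mul x y hx hy => rw [hmul, USl2.antipode_mul, hx, hy]

theorem USl2.antipode_aexp :
    USl2.antipode ħ (aexp (ħ • USl2.H ħ)) = aexp (-(ħ • USl2.H ħ)) ∧
      USl2.antipode ħ (aexp (-(ħ • USl2.H ħ))) = aexp (ħ • USl2.H ħ) := by
  have hop (a : USl2 ħ) (b : USl2 ħ) (hab : USl2.antipode ħ a = b) :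
      USl2.antipode ħ (aexp a) = aexp b := by
    subst hab
    refine congrArg MulOpposite.unop ((map_aexp (USl2.antipodeOp ħ) a).trans ?_)
    exact aexp_op (USl2.antipode ħ a)
  constructor
  · exact hop _ _ (by rw [map_smul, USl2.antipode_H, smul_neg])
  · exact hop _ _ (by rw [map_neg, map_smul, USl2.antipode_H, smul_neg, neg_neg])

/-- The automorphism `E ↦ c E`, `F ↦ c⁻¹ F`, `H ↦ H` of `Ũ(sl₂)_ħ`, for `c = e ^ t`. -/
def USl2.scale (t : ℂ) : USl2 ħ →A[ℂ] USl2 ħ :=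
  USl2.lift ((USl2.relations ħ).scale (c := Complex.exp t) (d := Complex.exp (-t))
    (by rw [← Complex.exp_add, add_neg_cancel, Complex.exp_zero]))

theorem USl2.scale_scale_neg (t : ℂ) (a : USl2 ħ) :
    USl2.scale ħ t (USl2.scale ħ (-t) a) = a := by
  have h : (USl2.scale ħ t).comp (USl2.scale ħ (-t)) = ContinuousAlgHom.id ℂ (USl2 ħ) := by
    apply USl2.hom_ext <;>
      simp [USl2.scale, smul_smul, ← Complex.exp_add]
  exact DFunLike.congr_fun h a

/-- The square of the antipode is the automorphism `E ↦ e ^ (2ħ) E`, `F ↦ e ^ (-2ħ) F`, `H ↦ H`. -/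
theorem USl2.antipode_antipode (a : USl2 ħ) :
    USl2.antipode ħ (USl2.antipode ħ a) = USl2.scale ħ (2 * ħ) a := by
  obtain ⟨hk, hk'⟩ := USl2.antipode_aexp ħ
  have hr := USl2.relations ħ
  let S2 : USl2 ħ →A[ℂ] USl2 ħ :=
    { toAlgHom := AlgHom.ofLinearMap ((USl2.antipode ħ).comp (USl2.antipode ħ)).toLinearMap
        (show USl2.antipode ħ (USl2.antipode ħ 1) = 1 by
          rw [USl2.antipode_one, USl2.antipode_one])
        (fun a b => show USl2.antipode ħ (USl2.antipode ħ (a * b)) =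
            USl2.antipode ħ (USl2.antipode ħ a) * USl2.antipode ħ (USl2.antipode ħ b) by
          rw [USl2.antipode_mul, USl2.antipode_mul])
      cont := ((USl2.antipode ħ).comp (USl2.antipode ħ)).continuous }
  have hS2 (a : USl2 ħ) : S2 a = USl2.antipode ħ (USl2.antipode ħ a) := rfl
  have h : S2 = USl2.scale ħ (2 * ħ) := by
    apply USl2.hom_ext
    · rw [hS2, USl2.antipode_E, map_neg, USl2.antipode_mul, hk', USl2.antipode_E, mul_neg, neg_neg,
        ← mul_assoc, hr.aexp_mul_e, smul_mul_assoc, mul_assoc, aexp_mul_aexp_neg, mul_one]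
      exact (USl2.lift_E _).symm
    · rw [hS2, USl2.antipode_F, map_neg, USl2.antipode_mul, hk, USl2.antipode_F, neg_mul, neg_neg,
        hr.aexp_mul_f, smul_mul_assoc, mul_assoc, aexp_mul_aexp_neg, mul_one]
      exact (USl2.lift_F _).symm
    · rw [hS2, USl2.antipode_H, map_neg, USl2.antipode_H, neg_neg]
      exact (USl2.lift_H _).symm
  rw [← hS2, h]

/-- The antipode is invertible because its square is. -/
theorem USl2.exists_antipode_inverse : ∃ T : USl2 ħ →L[ℂ] USl2 ħ,
    (∀ a, T (USl2.antipode ħ a) = a) ∧ ∀ a, USl2.antipode ħ (T a) = a := by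
  have hleft (a : USl2 ħ) :
      USl2.scale ħ (-(2 * ħ)) (USl2.antipode ħ (USl2.antipode ħ a)) = a := by
    simpa [USl2.antipode_antipode] using USl2.scale_scale_neg ħ (-(2 * ħ)) a
  refine ⟨(USl2.scale ħ (-(2 * ħ))).toContinuousLinearMap.comp (USl2.antipode ħ), hleft,
    fun a => ?_⟩
  obtain ⟨b, rfl⟩ : ∃ b, USl2.antipode ħ b = a :=
    ⟨USl2.antipode ħ (USl2.scale ħ (-(2 * ħ)) a), by
      rw [USl2.antipode_antipode, USl2.scale_scale_neg]⟩
  exact congrArg (USl2.antipode ħ) (hleft b)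

end USl2

end
end HFG

theorem proposition5p2 (ħ : ℂ) (hħ : Complex.sinh ħ ≠ 0) :
    -- `Ũ(sl₂)_ħ` is the universal HFG algebra generated by `E`, `F`, `H` subject to the relations
    (IsHFG (USl2 ħ) ∧
      Sl2Relations ħ (USl2.E ħ) (USl2.F ħ) (USl2.H ħ) ∧
      ∀ (B : Type*) [Ring B] [Algebra ℂ B] [UniformSpace B], IsHFG B →
        ∀ e f h : B, Sl2Relations ħ e f h →
          ∃! φ : USl2 ħ →A[ℂ] B, φ (USl2.E ħ) = e ∧ φ (USl2.F ħ) = f ∧ φ (USl2.H ħ) = h) ∧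
    -- it is infinite-dimensional
    ¬ FiniteDimensional ℂ (USl2 ħ) ∧
    -- it is a Hopf `⊗̂`-algebra with the given comultiplication, counit and antipode, each of which
    -- is determined by its values on the generators
    ∃ (Δ : USl2 ħ →A[ℂ] CTensor (USl2 ħ) (USl2 ħ)) (ε : USl2 ħ →A[ℂ] ℂ)
      (S : USl2 ħ →L[ℂ] USl2 ħ),
      IsHopfCTensor (USl2 ħ) Δ ε S ∧
      (∀ Δ' : USl2 ħ →A[ℂ] CTensor (USl2 ħ) (USl2 ħ),
        (Δ' (USl2.H ħ) = CTensor.mk _ _ (USl2.H ħ) 1 + CTensor.mk _ _ 1 (USl2.H ħ) ∧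
          Δ' (USl2.E ħ) = CTensor.mk _ _ (USl2.E ħ) (aexp (ħ • USl2.H ħ)) +
            CTensor.mk _ _ 1 (USl2.E ħ) ∧
          Δ' (USl2.F ħ) = CTensor.mk _ _ (USl2.F ħ) 1 +
            CTensor.mk _ _ (aexp (-(ħ • USl2.H ħ))) (USl2.F ħ)) ↔ Δ' = Δ) ∧
      (∀ ε' : USl2 ħ →A[ℂ] ℂ,
        (ε' (USl2.H ħ) = 0 ∧ ε' (USl2.E ħ) = 0 ∧ ε' (USl2.F ħ) = 0) ↔ ε' = ε) ∧
      (∀ S' : USl2 ħ →L[ℂ] USl2 ħ,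
        (S' 1 = 1 ∧ (∀ a b, S' (a * b) = S' b * S' a) ∧
          S' (USl2.H ħ) = -USl2.H ħ ∧
          S' (USl2.E ħ) = -(USl2.E ħ * aexp (-(ħ • USl2.H ħ))) ∧
          S' (USl2.F ħ) = -(aexp (ħ • USl2.H ħ) * USl2.F ħ)) ↔ S' = S) ∧
      -- the antipode is invertible
      ∃ T : USl2 ħ →L[ℂ] USl2 ħ, (∀ a, T (S a) = a) ∧ ∀ a, S (T a) = a := by
  refine ⟨⟨USl2.isHFG ħ, USl2.relations ħ, fun B _ _ _ hB e f h hr => ?_⟩,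
    USl2.not_finiteDimensional hħ, USl2.comul ħ, USl2.counit ħ, USl2.antipode ħ, ?_, fun Δ' => ?_,
    fun ε' => ?_, fun S' => ?_, USl2.exists_antipode_inverse ħ⟩
  · have := hB.isUniformAddGroup
    have := hB.completeSpace
    have := hB.t2Space
    have := hB.toIsArensMichael.isTopologicalRing
    have := hB.toIsArensMichael.locallyMConvex
    exact ⟨USl2.lift hr, ⟨USl2.lift_E hr, USl2.lift_F hr, USl2.lift_H hr⟩, fun φ ⟨hE, hF, hH⟩ =>
      USl2.hom_ext (hE.trans (USl2.lift_E hr).symm) (hF.trans (USl2.lift_F hr).symm)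
        (hH.trans (USl2.lift_H hr).symm)⟩
  · exact Sl2Relations.isHopfCTensor (USl2.dense_adjoin ħ) (USl2.lift_H _) (USl2.lift_E _)
      (USl2.lift_F _) (USl2.lift_H _) (USl2.lift_E _) (USl2.lift_F _) (USl2.antipode_one ħ)
      (USl2.antipode_mul ħ) (USl2.antipode_H ħ) (USl2.antipode_E ħ) (USl2.antipode_F ħ)
  · refine ⟨fun ⟨hH, hE, hF⟩ => USl2.hom_ext (hE.trans (USl2.lift_E _).symm)
      (hF.trans (USl2.lift_F _).symm) (hH.trans (USl2.lift_H _).symm), ?_⟩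
    rintro rfl
    exact ⟨USl2.lift_H _, USl2.lift_E _, USl2.lift_F _⟩
  · refine ⟨fun ⟨hH, hE, hF⟩ => USl2.hom_ext (hE.trans (USl2.lift_E _).symm)
      (hF.trans (USl2.lift_F _).symm) (hH.trans (USl2.lift_H _).symm), ?_⟩
    rintro rfl
    exact ⟨USl2.lift_H _, USl2.lift_E _, USl2.lift_F _⟩
  · refine ⟨fun ⟨h1, hmul, hH, hE, hF⟩ => USl2.antipode_unique ħ h1 hmul hH hE hF, ?_⟩
    rintro rfl
    exact ⟨USl2.antipode_one ħ, USl2.antipode_mul ħ, USl2.antipode_H ħ, USl2.antipode_E ħ,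
      USl2.antipode_F ħ⟩
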